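/- **Proposition 3.1 (scaled Poincaré inequality in $\mathbb V_{\mathcal T}$).** *Meshes.* Let $\Omega\subset\mathbb R^2$ be a polygonal domain (a bounded connected open set whose boundary is a finite union of segments) and let $\mathcal T_0$ be a conforming partition of $\overline\Omega$ into nondegenerate triangles, each marked with a newest vertex. The newest-vertex bisection of a triangle halves the edge opposite to its newest vertex and makes the midpoint the newest vertex of both children. Let $\mathcal T$ be obtained from $\mathcal T_0$ by finitely many successive newest-vertex element bisections (hanging nodes are allowed). The nodes of $\mathcal T$ are the vertices of its triangles; a node is *proper* if it is a vertex of all triangles of $\mathcal T$ that contain it, and *hanging* otherwise. The *global index* $\lambda(\boldsymbol x)$ of a node is $0$ if $\boldsymbol x$ is proper, and $\max(\lambda(\boldsymbol x'),\lambda(\boldsymbol x''))+1$ if $\boldsymbol x$ is hanging and was created by a bisection halving an edge with endpoints $\boldsymbol x',\boldsymbol x''$. For an integer $\Lambda\ge 1$, $\mathcal T$ is *$\Lambda$-admissible* if $\lambda(\boldsymbol x)\le\Lambda$ for all nodes $\boldsymbol x$. *Spaces.* For $E\in\mathcal T$ let $\mathcal N_E$ be the set of nodes of $\mathcal T$ lying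 on $\partial E$; they divide $\partial E$ into the edges of $E$. Let $\mathbb V_{\partial E}$ be the space of continuous functions on $\partial E$ that are affine on each edge of $E$. For each $E\in\mathcal T$ let $\mathbb V_E\subset C^0(E)$ be any finite dimensional space with $\dim \mathbb V_E=|\mathcal N_E|$, $\mathbb P_1(E)\subseteq\mathbb V_E$, and whose set of traces on $\partial E$ is $\mathbb V_{\partial E}$. Set $\mathbb V_{\mathcal T}=\{v\in H^1_0(\Omega): v_{|E}\in\mathbb V_E\ \forall E\in\mathcal T\}$ and $h_E=|E|^{1/2}$. *Claim.* For all $\Lambda\ge1$ and $\sigma$ there is a constant $C>0$, depending only on $\Lambda$ and $\sigma$, such that for all $\Omega$, $\mathcal T_0$ as above with $\operatorname{diam}(T)^2\le\sigma|T|$ for every $T\in\mathcal T_0$, for every $\Lambda$-admissible $\mathcal T$ and every choice of spaces $\mathbb V_E$ as above, $$\sum_{E\in\mathcal T} h_E^{-2}\|v\|_{0,E}^2\le C\,|v|_{1,\Omega}^2\qquad\text{for all } v\in\mathbb V_{\mathcal T}\text{ that vanish at all proper nodes of }\mathcal T .$$ -/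

import Mathlib

open MeasureTheory Filter Topology
open scoped ContDiff

/-- The Euclidean plane. -/
abbrev Plane : Type := EuclideanSpace ℝ (Fin 2)

/-! ### Triangles and newest-vertex bisection -/

/-- A triangle marked for newest-vertex bisection: `apex` is its newest vertex, and the opposite
edge, with endpoints `left` and `right`, is the edge that a bisection halves. -/
@[ext]
structure MarkedTriangle where
  apex : Plane
  left : Plane
  right : Plane

noncomputable instance MarkedTriangle.instDecidableEq : DecidableEq MarkedTriangle :=
  Classical.decEq _

namespace MarkedTriangle

/-- The three vertices. -/
def vertices (T : MarkedTriangle) : Set Plane := {T.apex, T.left, T.right}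

/-- The closed triangle as a subset of the plane. -/
def carrier (T : MarkedTriangle) : Set Plane := convexHull ℝ T.vertices

/-- The three vertices are not collinear. -/
def Nondegenerate (T : MarkedTriangle) : Prop := AffineIndependent ℝ ![T.apex, T.left, T.right]

/-- The area `|T|`. -/
noncomputable def area (T : MarkedTriangle) : ℝ := volume.real T.carrier

/-- The size `h_T = |T|^{1/2}`. -/
noncomputable def size (T : MarkedTriangle) : ℝ := Real.sqrt T.area

/-- The midpoint of the edge opposite to the newest vertex. -/
noncomputable def mid (T : MarkedTriangle) : Plane := midpoint ℝ T.left T.right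

/-- First child of the newest-vertex bisection; its newest vertex is the new midpoint. -/
noncomputable def child₁ (T : MarkedTriangle) : MarkedTriangle := ⟨T.mid, T.apex, T.left⟩

/-- Second child of the newest-vertex bisection; its newest vertex is the new midpoint. -/
noncomputable def child₂ (T : MarkedTriangle) : MarkedTriangle := ⟨T.mid, T.right, T.apex⟩

theorem isClosed_carrier (T : MarkedTriangle) : IsClosed T.carrier := by
  have h : T.vertices.Finite := by unfold vertices; exact Set.toFinite _
  exact (h.isCompact_convexHull (𝕜 := ℝ)).isClosed

theorem frontier_subset_carrier (T : MarkedTriangle) : frontier T.carrier ⊆ T.carrier :=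
  T.isClosed_carrier.frontier_subset

end MarkedTriangle

/-! ### Domains and meshes -/

/-- Bounded connected open sets whose boundary is a finite union of segments. -/
structure IsPolygonalDomain (Ω : Set Plane) : Prop where
  isOpen : IsOpen Ω
  isConnected : IsConnected Ω
  isBounded : Bornology.IsBounded Ω
  boundary : ∃ S : Finset (Plane × Plane), frontier Ω = ⋃ s ∈ S, segment ℝ s.1 s.2

/-- `T₀` is a conforming partition of the closure of `Ω` into (marked) triangles: the triangles
are nondegenerate, cover the closure, do not overlap, and any two of them meet in the empty set,
in a common vertex or in a common edge. -/
structure IsConformingPartition (Ω : Set Plane) (T₀ : Finset MarkedTriangle) : Prop where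
  nondegenerate : ∀ T ∈ T₀, T.Nondegenerate
  cover : (⋃ T ∈ T₀, T.carrier) = closure Ω
  nonoverlapping : ∀ S ∈ T₀, ∀ T ∈ T₀, S ≠ T → Disjoint (interior S.carrier) (interior T.carrier)
  conforming : ∀ S ∈ T₀, ∀ T ∈ T₀, S ≠ T →
    S.carrier ∩ T.carrier = convexHull ℝ (S.vertices ∩ T.vertices)

/-- The shape of the triangles of `T₀` is controlled by `σ`: `diam(T)² ≤ σ |T|`. -/
def IsShapeRegular (σ : ℝ) (T₀ : Finset MarkedTriangle) : Prop :=
  ∀ T ∈ T₀, Metric.diam T.carrier ^ 2 ≤ σ * T.area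

/-- `T'` is obtained from `T` by the newest-vertex bisection of one element. -/
def BisectionStep (T T' : Finset MarkedTriangle) : Prop :=
  ∃ E ∈ T, T' = T.erase E ∪ {E.child₁, E.child₂}

/-- `T` is obtained from `T₀` by finitely many successive newest-vertex element bisections. -/
def IsRefinement (T₀ T : Finset MarkedTriangle) : Prop := Relation.ReflTransGen BisectionStep T₀ T

/-- Membership in the infinite binary forest generated from `T₀` by newest-vertex bisection. -/
inductive InBisectionTree (T₀ : Finset MarkedTriangle) : MarkedTriangle → Prop
  | root (T : MarkedTriangle) : T ∈ T₀ → InBisectionTree T₀ T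
  | child₁ (T : MarkedTriangle) : InBisectionTree T₀ T → InBisectionTree T₀ T.child₁
  | child₂ (T : MarkedTriangle) : InBisectionTree T₀ T → InBisectionTree T₀ T.child₂

/-- The nodes of a mesh: all vertices of its elements. -/
def nodes (T : Finset MarkedTriangle) : Set Plane := {x | ∃ E ∈ T, x ∈ E.vertices}

/-- The proper nodes: vertices of all the elements that contain them. -/
def properNodes (T : Finset MarkedTriangle) : Set Plane :=
  {x | x ∈ nodes T ∧ ∀ E ∈ T, x ∈ E.carrier → x ∈ E.vertices}

/-- The hanging nodes: the nodes that are not proper. -/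
def hangingNodes (T : Finset MarkedTriangle) : Set Plane := nodes T \ properNodes T

/-- `HasGlobalIndex T₀ T x n` says that the node `x` of the refinement `T` of `T₀` has global
index `n`. A proper node has index `0`. A hanging node is the midpoint of the edge
`[S.left, S.right]` that was halved in the bisection of a triangle `S` generated from `T₀`, and its
index is one more than the larger of the indices of the two endpoints. (All triangles of the forest
whose bisection creates the point `x` halve the same edge.) -/
inductive HasGlobalIndex (T₀ T : Finset MarkedTriangle) : Plane → ℕ → Prop
  | proper (x : Plane) : x ∈ properNodes T → HasGlobalIndex T₀ T x 0
  | hanging (x : Plane) (S : MarkedTriangle) (m n : ℕ) : x ∈ hangingNodes T →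
      InBisectionTree T₀ S → S.mid = x → HasGlobalIndex T₀ T S.left m →
      HasGlobalIndex T₀ T S.right n → HasGlobalIndex T₀ T x (max m n + 1)

/-- The mesh `T` is `Λ`-admissible: the global index of every node is at most `Λ`. -/
def IsAdmissible (T₀ : Finset MarkedTriangle) (Λ : ℕ) (T : Finset MarkedTriangle) : Prop :=
  ∀ x ∈ nodes T, ∃ n, HasGlobalIndex T₀ T x n ∧ n ≤ Λ

/-! ### Sobolev spaces -/

/-- Test functions: smooth with compact support contained in `Ω`. -/
structure IsTestFunction (Ω : Set Plane) (φ : Plane → ℝ) : Prop where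
  contDiff : ContDiff ℝ ∞ φ
  hasCompactSupport : HasCompactSupport φ
  tsupport_subset : tsupport φ ⊆ Ω

/-- `v ∈ H¹(Ω)` with weak gradient `G`. -/
structure MemH1 (Ω : Set Plane) (v : Plane → ℝ) (G : Plane → Plane) : Prop where
  memLp : MemLp v 2 (volume.restrict Ω)
  memLp_grad : MemLp G 2 (volume.restrict Ω)
  weak_grad : ∀ φ : Plane → ℝ, IsTestFunction Ω φ →
    ∫ x in Ω, v x • gradient φ x = -∫ x in Ω, φ x • G x

/-- `v ∈ H¹₀(Ω)` with weak gradient `G`: a limit in `H¹(Ω)` of test functions. -/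
structure MemH10 (Ω : Set Plane) (v : Plane → ℝ) (G : Plane → Plane) : Prop
    extends MemH1 Ω v G where
  approx : ∃ φ : ℕ → Plane → ℝ, (∀ k, IsTestFunction Ω (φ k)) ∧
    Tendsto (fun k => eLpNorm (fun x => φ k x - v x) 2 (volume.restrict Ω)) atTop (𝓝 0) ∧
    Tendsto (fun k => eLpNorm (fun x => gradient (φ k) x - G x) 2 (volume.restrict Ω)) atTop (𝓝 0)

/-! ### Virtual element spaces -/

/-- The nodes of the mesh sitting on the boundary of the element `E`. -/
def nodesOn (T : Finset MarkedTriangle) (E : MarkedTriangle) : Set Plane :=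
  nodes T ∩ frontier E.carrier

/-- `[a, b]` is an edge of the element `E`, viewed as a polygon whose vertices are all the nodes
on its boundary. -/
structure IsEdge (T : Finset MarkedTriangle) (E : MarkedTriangle) (a b : Plane) : Prop where
  left_mem : a ∈ nodesOn T E
  right_mem : b ∈ nodesOn T E
  ne : a ≠ b
  segment_subset : segment ℝ a b ⊆ frontier E.carrier
  no_node : ∀ z ∈ nodesOn T E, z ∉ openSegment ℝ a b

/-- Continuous functions on the boundary of `E` that are affine on each edge of `E`. -/
def boundarySpace (T : Finset MarkedTriangle) (E : MarkedTriangle) :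
    Submodule ℝ C(frontier E.carrier, ℝ) where
  carrier := {g | ∀ a b, IsEdge T E a b → ∃ (L : Plane →ₗ[ℝ] ℝ) (c : ℝ),
    ∀ x : frontier E.carrier, (x : Plane) ∈ segment ℝ a b → g x = L x + c}
  zero_mem' := fun _ _ _ => ⟨0, 0, fun _ _ => by simp⟩
  add_mem' := by
    intro f g hf hg a b h
    obtain ⟨L, c, hL⟩ := hf a b h
    obtain ⟨M, d, hM⟩ := hg a b h
    refine ⟨L + M, c + d, fun x hx => ?_⟩
    simp only [ContinuousMap.add_apply, hL x hx, hM x hx, LinearMap.add_apply]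
    ring
  smul_mem' := by
    intro r f hf a b h
    obtain ⟨L, c, hL⟩ := hf a b h
    refine ⟨r • L, r * c, fun x hx => ?_⟩
    simp only [ContinuousMap.smul_apply, hL x hx, LinearMap.smul_apply, smul_eq_mul]
    ring

/-- Restriction of continuous functions on `E` to the boundary of `E`. -/
def boundaryTrace (E : MarkedTriangle) : C(E.carrier, ℝ) →ₗ[ℝ] C(frontier E.carrier, ℝ) where
  toFun w := w.comp ⟨Set.inclusion E.frontier_subset_carrier, continuous_inclusion _⟩
  map_add' _ _ := rfl
  map_smul' _ _ := rfl

/-- `W` is an admissible local virtual element space on the element `E`: a finite dimensional space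
of continuous functions on `E`, of dimension the number of nodes on the boundary of `E`, that
contains the affine functions and whose boundary traces are the continuous functions on the
boundary that are affine on each edge. -/
structure IsLocalVEMSpace (T : Finset MarkedTriangle) (E : MarkedTriangle)
    (W : Submodule ℝ C(E.carrier, ℝ)) : Prop where
  finite : Module.Finite ℝ W
  finrank_eq : Module.finrank ℝ W = (nodesOn T E).ncard
  affine_mem : ∀ (L : Plane →ₗ[ℝ] ℝ) (c : ℝ) (w : C(E.carrier, ℝ)),
    (∀ x : E.carrier, w x = L x + c) → w ∈ W
  trace_eq : W.map (boundaryTrace E) = boundarySpace T E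

/-- `v`, with weak gradient `G`, belongs to the global virtual element space: `v ∈ H¹₀(Ω)` and
`v|_E ∈ V E` for every element `E`. -/
structure MemVEMSpace (Ω : Set Plane) (T : Finset MarkedTriangle)
    (V : (E : MarkedTriangle) → Submodule ℝ C(E.carrier, ℝ))
    (v : Plane → ℝ) (G : Plane → Plane) : Prop where
  memH10 : MemH10 Ω v G
  restrict_mem : ∀ E ∈ T, ∃ w ∈ V E, ∀ x : E.carrier, w x = v x

/-! In the plane the $H^1$ norm does not control point values, and the spaces on the elements may
contain arbitrary functions in the interior. What saves the estimate is that `v` is affine on each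
edge of an element, and that in a `Λ`-admissible mesh every node `p` on the boundary of `E` is the
end of an edge of length comparable to the diameter of `E`. The value of an affine function at an
end of a segment is bounded by its mean square on that segment, so a trace and Poincaré inequality
gives $\int_E |v-v(p)|^2\le C|E|\int_E|\nabla v|^2$ (`lintegral_sub_node_le`). Hence two nodal
values on the same element satisfy $|v(p)-v(q)|^2\le 4C\int_E|\nabla v|^2$, with no power of the
mesh size (`sq_sub_node_le`).

The geometry rests on `IsConformingPartition.halved_edge_subset`: if a bisection creates a point
inside an edge of an element `E`, then the whole halved edge lies in that edge of `E`. The reason is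
that edges of descendants lying on a common edge of two neighbours are dyadic intervals, which are
nested or do not overlap. It has two consequences. By induction, nodes of index at most `n` on an
edge sit on its grid with `2 ^ n` intervals, which gives the long edges and bounds the number of
nodes per element. Moreover, a hanging node and the two endpoints it was created from lie on the
boundary of one and the same element.

The nodal values are then controlled by induction on the global index (`sum_sq_lowNodes_le`). They
vanish at index 0; the square at a hanging node is at most twice the square of its difference from a
parent plus twice the square at the parent. The sums close because each element has boundedly many
nodes and each point lies in boundedly many elements (`IsRefinement.card_filter_le`). Finally, the
element inequality around the apex of each element, summed over the mesh, gives the claim. -/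

namespace MarkedTriangle

/-- The vertices as a family: apex, left, right. -/
def vert (T : MarkedTriangle) : Fin 3 → Plane := ![T.apex, T.left, T.right]

@[simp] theorem vert_zero (T : MarkedTriangle) : T.vert 0 = T.apex := rfl
@[simp] theorem vert_one (T : MarkedTriangle) : T.vert 1 = T.left := rfl
@[simp] theorem vert_two (T : MarkedTriangle) : T.vert 2 = T.right := rfl

theorem range_vert (T : MarkedTriangle) : Set.range T.vert = T.vertices := by
  ext x
  simp only [Set.mem_range, Fin.exists_fin_succ, vertices, Set.mem_insert_iff,
    Set.mem_singleton_iff, vert]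
  simp [eq_comm]

theorem mem_vertices_iff (T : MarkedTriangle) {x : Plane} : x ∈ T.vertices ↔ ∃ i, x = T.vert i := by
  rw [← range_vert]
  simp [eq_comm]

theorem vert_mem_vertices (T : MarkedTriangle) (i : Fin 3) : T.vert i ∈ T.vertices :=
  T.mem_vertices_iff.2 ⟨i, rfl⟩

theorem convex_carrier (T : MarkedTriangle) : Convex ℝ T.carrier := convex_convexHull _ _

theorem vertices_subset_carrier (T : MarkedTriangle) : T.vertices ⊆ T.carrier :=
  subset_convexHull _ _

theorem vert_mem_carrier (T : MarkedTriangle) (i : Fin 3) : T.vert i ∈ T.carrier :=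
  T.vertices_subset_carrier (T.vert_mem_vertices i)

theorem apex_mem_carrier (T : MarkedTriangle) : T.apex ∈ T.carrier := T.vert_mem_carrier 0
theorem left_mem_carrier (T : MarkedTriangle) : T.left ∈ T.carrier := T.vert_mem_carrier 1
theorem right_mem_carrier (T : MarkedTriangle) : T.right ∈ T.carrier := T.vert_mem_carrier 2

theorem isCompact_carrier (T : MarkedTriangle) : IsCompact T.carrier := by
  have h : T.vertices.Finite := by unfold vertices; exact Set.toFinite _
  exact h.isCompact_convexHull (𝕜 := ℝ)

/-- The edge opposite to the vertex `i`. -/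
def edge (T : MarkedTriangle) (i : Fin 3) : Set Plane :=
  segment ℝ (T.vert (i + 1)) (T.vert (i + 2))

theorem edge_subset_carrier (T : MarkedTriangle) (i : Fin 3) : T.edge i ⊆ T.carrier :=
  T.convex_carrier.segment_subset (T.vert_mem_carrier _) (T.vert_mem_carrier _)

/-- The vertices of a nondegenerate triangle form an affine basis of the plane. -/
noncomputable def Nondegenerate.basis {T : MarkedTriangle} (h : T.Nondegenerate) :
    AffineBasis (Fin 3) ℝ Plane :=
  ⟨T.vert, h, by
    have h' : AffineIndependent ℝ T.vert := h
    rw [h'.affineSpan_eq_top_iff_card_eq_finrank_add_one]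
    simp⟩

/-! ### Barycentric coordinates of a nondegenerate triangle. -/

namespace Nondegenerate

theorem basis_apply {T : MarkedTriangle} (h : T.Nondegenerate)
    (i : Fin 3) : h.basis i = T.vert i := rfl

/-- The barycentric coordinates. -/
noncomputable def bary {T : MarkedTriangle} (h : T.Nondegenerate)
    (i : Fin 3) : Plane →ᵃ[ℝ] ℝ := h.basis.coord i

theorem bary_vert {T : MarkedTriangle} (h : T.Nondegenerate)
    (i j : Fin 3) : h.bary i (T.vert j) = if i = j then 1 else 0 :=
  h.basis.coord_apply i j

theorem bary_vert_ne {T : MarkedTriangle} (h : T.Nondegenerate)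
    {i j : Fin 3} (hij : i ≠ j) : h.bary i (T.vert j) = 0 := by
  simp [bary_vert, hij]

theorem coe_basis {T : MarkedTriangle} (h : T.Nondegenerate) :
    (h.basis : Fin 3 → Plane) = T.vert := rfl

theorem mem_carrier_iff {T : MarkedTriangle} (h : T.Nondegenerate)
    {x : Plane} : x ∈ T.carrier ↔ ∀ i, 0 ≤ h.bary i x := by
  have := h.basis.convexHull_eq_nonneg_coord
  rw [coe_basis, range_vert] at this
  rw [carrier, this]
  rfl

theorem mem_interior_iff {T : MarkedTriangle} (h : T.Nondegenerate)
    {x : Plane} : x ∈ interior T.carrier ↔ ∀ i, 0 < h.bary i x := by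
  have := h.basis.interior_convexHull
  rw [coe_basis, range_vert] at this
  rw [carrier, this]
  rfl

theorem bary_sum {T : MarkedTriangle} (h : T.Nondegenerate)
    (x : Plane) : h.bary 0 x + h.bary 1 x + h.bary 2 x = 1 := by
  have := h.basis.sum_coord_apply_eq_one x
  rwa [Fin.sum_univ_three] at this

theorem bary_sum' {T : MarkedTriangle} (h : T.Nondegenerate) (i : Fin 3) (x : Plane) :
    h.bary i x + h.bary (i + 1) x + h.bary (i + 2) x = 1 := by
  have := h.bary_sum x
  fin_cases i <;> simp <;> linarith

theorem bary_comb {T : MarkedTriangle} (h : T.Nondegenerate) (i : Fin 3) (x : Plane) :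
    h.bary i x • T.vert i + h.bary (i + 1) x • T.vert (i + 1)
      + h.bary (i + 2) x • T.vert (i + 2) = x := by
  have h1 := h.basis.linear_combination_coord_eq_self x
  rw [Fin.sum_univ_three] at h1
  simp only [basis_apply] at h1
  change h.bary 0 x • _ + h.bary 1 x • _ + h.bary 2 x • _ = x at h1
  conv_rhs => rw [← h1]
  fin_cases i <;> simp <;> abel

theorem injective_vert {T : MarkedTriangle} (h : T.Nondegenerate) :
    Function.Injective T.vert := h.basis.ind.injective

theorem mem_edge_of_bary {T : MarkedTriangle} (h : T.Nondegenerate)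
    {i : Fin 3} {x : Plane} (hx : x ∈ T.carrier) (h0 : h.bary i x = 0) :
    x ∈ T.edge i := by
  have hp := h.mem_carrier_iff.1 hx
  refine ⟨h.bary (i + 1) x, h.bary (i + 2) x, hp _, hp _, ?_, ?_⟩
  · have := h.bary_sum' i x
    linarith
  · have := h.bary_comb i x
    rwa [h0, zero_smul, zero_add] at this

theorem bary_convexComb {T : MarkedTriangle} (h : T.Nondegenerate)
    (i : Fin 3) {a b : ℝ} (hab : a + b = 1) (x y : Plane) :
    h.bary i (a • x + b • y) = a * h.bary i x + b * h.bary i y := by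
  rw [Convex.combo_affine_apply hab]
  simp

theorem bary_edge {T : MarkedTriangle} (h : T.Nondegenerate)
    {i : Fin 3} {x : Plane} (hx : x ∈ T.edge i) : h.bary i x = 0 := by
  obtain ⟨a, b, -, -, hab, rfl⟩ := hx
  rw [h.bary_convexComb i hab, h.bary_vert_ne, h.bary_vert_ne] <;> simp

theorem affine_apply {T : MarkedTriangle} (h : T.Nondegenerate) (f : Plane →ᵃ[ℝ] ℝ) (x : Plane) :
    f x = h.bary 0 x * f T.apex + h.bary 1 x * f T.left + h.bary 2 x * f T.right := by
  have h1 := h.bary_comb 0 x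
  have h2 := h.bary_sum x
  simp only [zero_add, vert_zero, vert_one, vert_two] at h1
  have hf : ∀ y, f y = f.linear y + f 0 := fun y => congrFun f.decomp y
  conv_lhs => rw [← h1]
  rw [hf, hf T.apex, hf T.left, hf T.right]
  simp only [map_add, map_smul, smul_eq_mul]
  linear_combination (-f 0) * h2

theorem interior_nonempty {T : MarkedTriangle} (h : T.Nondegenerate) :
    (interior T.carrier).Nonempty := by
  refine ⟨(1/3 : ℝ) • T.vert 0 + (2/3 : ℝ) • ((1/2 : ℝ) • T.vert 1 + (1/2 : ℝ) • T.vert 2), ?_⟩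
  rw [h.mem_interior_iff]
  intro i
  rw [h.bary_convexComb i (by norm_num), h.bary_convexComb i (by norm_num)]
  fin_cases i <;> simp [bary_vert, -vert_zero, -vert_one, -vert_two]

theorem edge_subset_frontier {T : MarkedTriangle} (h : T.Nondegenerate)
    (i : Fin 3) : T.edge i ⊆ frontier T.carrier := by
  intro x hx
  rw [T.isClosed_carrier.frontier_eq]
  refine ⟨T.edge_subset_carrier i hx, fun hi => ?_⟩
  have := h.mem_interior_iff.1 hi i
  rw [h.bary_edge hx] at this
  exact lt_irrefl _ this

theorem exists_edge_of_mem_frontier {T : MarkedTriangle} (h : T.Nondegenerate)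
    {x : Plane} (hx : x ∈ frontier T.carrier) :
    ∃ i, x ∈ T.edge i := by
  rw [T.isClosed_carrier.frontier_eq] at hx
  obtain ⟨hx, hi⟩ := hx
  rw [h.mem_interior_iff] at hi
  push Not at hi
  obtain ⟨i, hi⟩ := hi
  exact ⟨i, h.mem_edge_of_bary hx (le_antisymm hi (h.mem_carrier_iff.1 hx i))⟩

/-- Edges are extreme faces: a convex combination of nonnegative numbers with positive weights
vanishes only if both numbers do. -/
theorem bary_eq_zero_of_openSegment {T : MarkedTriangle} (h : T.Nondegenerate)
    {i : Fin 3} {x y z : Plane} (hy : y ∈ T.carrier)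
    (hz : z ∈ T.carrier) (hx : x ∈ openSegment ℝ y z) (h0 : h.bary i x = 0) :
    h.bary i y = 0 ∧ h.bary i z = 0 := by
  obtain ⟨a, b, ha, hb, hab, rfl⟩ := hx
  rw [h.bary_convexComb i hab] at h0
  have hy' := h.mem_carrier_iff.1 hy i
  have hz' := h.mem_carrier_iff.1 hz i
  have h1 : a * h.bary i y = 0 := by nlinarith [mul_nonneg ha.le hy', mul_nonneg hb.le hz']
  have h2 : b * h.bary i z = 0 := by nlinarith [mul_nonneg ha.le hy', mul_nonneg hb.le hz']
  exact ⟨(mul_eq_zero.1 h1).resolve_left ha.ne', (mul_eq_zero.1 h2).resolve_left hb.ne'⟩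

/-- Vertices are extreme points: a vertex is the common zero of two nonnegative coordinates, and
both must vanish at the ends of the segment. -/
theorem eq_vert_of_openSegment {T : MarkedTriangle} (h : T.Nondegenerate)
    {i : Fin 3} {y z : Plane} (hy : y ∈ T.carrier)
    (hz : z ∈ T.carrier) (hx : T.vert i ∈ openSegment ℝ y z) : y = T.vert i ∧ z = T.vert i := by
  have h1 := h.bary_eq_zero_of_openSegment (i := i + 1) hy hz hx (h.bary_vert_ne (by simp))
  have h2 := h.bary_eq_zero_of_openSegment (i := i + 2) hy hz hx (h.bary_vert_ne (by simp))
  have key : ∀ w, h.bary (i + 1) w = 0 → h.bary (i + 2) w = 0 → w = T.vert i := by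
    intro w hw1 hw2
    have h3 := h.bary_sum' i w
    have h4 := h.bary_comb i w
    rw [hw1, hw2] at h3 h4
    have : h.bary i w = 1 := by linarith
    rw [this] at h4
    simpa using h4.symm
  exact ⟨key y h1.1 h2.1, key z h1.2 h2.2⟩

theorem exists_openSegment {T : MarkedTriangle} (h : T.Nondegenerate)
    {x : Plane} (hx : x ∈ frontier T.carrier) (hv : x ∉ T.vertices) :
    ∃ i, x ∈ openSegment ℝ (T.vert (i + 1)) (T.vert (i + 2)) := by
  obtain ⟨i, hi⟩ := h.exists_edge_of_mem_frontier hx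
  refine ⟨i, mem_openSegment_of_ne_left_right ?_ ?_ hi⟩
  · rintro rfl; exact hv (T.vert_mem_vertices _)
  · rintro rfl; exact hv (T.vert_mem_vertices _)

end Nondegenerate

/-! ### Area and shape -/

/-- The cross product of two plane vectors. -/
def _root_.planeCross (u w : Plane) : ℝ := u 0 * w 1 - u 1 * w 0

/-- Twice the signed area. -/
def cross (T : MarkedTriangle) : ℝ := planeCross (T.left - T.apex) (T.right - T.apex)

/-- The sum of the squared lengths of the edges through the newest vertex. -/
noncomputable def sumSq (T : MarkedTriangle) : ℝ :=
  ‖T.left - T.apex‖ ^ 2 + ‖T.right - T.apex‖ ^ 2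

theorem _root_.Plane.norm_sq (u : Plane) : ‖u‖ ^ 2 = u 0 ^ 2 + u 1 ^ 2 := by
  rw [EuclideanSpace.norm_sq_eq]
  simp

theorem mid_apply (T : MarkedTriangle) (i : Fin 2) : T.mid i = (T.left i + T.right i) / 2 := by
  simp [mid, midpoint_eq_smul_add]
  ring

/-- This is the median formula of Apollonius. Bisection halves this quadratic quantity exactly, as
it halves the area, so their ratio is an invariant that measures the shape along the whole bisection
tree. -/
theorem sumSq_child₁ (T : MarkedTriangle) : T.child₁.sumSq = T.sumSq / 2 := by
  simp only [sumSq, child₁, Plane.norm_sq, PiLp.sub_apply, mid_apply]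
  ring

theorem sumSq_child₂ (T : MarkedTriangle) : T.child₂.sumSq = T.sumSq / 2 := by
  simp only [sumSq, child₂, Plane.norm_sq, PiLp.sub_apply, mid_apply]
  ring

theorem cross_child₁ (T : MarkedTriangle) : T.child₁.cross = T.cross / 2 := by
  simp only [cross, planeCross, child₁, PiLp.sub_apply, mid_apply]
  ring

theorem cross_child₂ (T : MarkedTriangle) : T.child₂.cross = T.cross / 2 := by
  simp only [cross, planeCross, child₂, PiLp.sub_apply, mid_apply]
  ring

theorem nondegenerate_of_cross_ne_zero {T : MarkedTriangle} (hT : T.cross ≠ 0) :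
    T.Nondegenerate := by
  rw [Nondegenerate, affineIndependent_iff_linearIndependent_vsub ℝ _ (0 : Fin 3)]
  have e : LinearIndependent ℝ ![T.left - T.apex, T.right - T.apex] := by
    rw [LinearIndependent.pair_iff]
    intro s t hst
    have h0 := congrArg (fun x : Plane => x 0) hst
    have h1 := congrArg (fun x : Plane => x 1) hst
    simp only [cross, planeCross] at hT
    set u := T.left - T.apex
    set w := T.right - T.apex
    simp at h0 h1
    constructor
    · have : s * (u 0 * w 1 - u 1 * w 0) = 0 := by linear_combination w 1 * h0 - w 0 * h1
      exact (mul_eq_zero.1 this).resolve_right hT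
    · have : t * (u 0 * w 1 - u 1 * w 0) = 0 := by linear_combination u 0 * h1 - u 1 * h0
      exact (mul_eq_zero.1 this).resolve_right hT
  have := e.comp (fun i : {x : Fin 3 // x ≠ 0} => i.1.pred i.2) (by
    rintro ⟨i, hi⟩ ⟨j, hj⟩ hij
    simpa using hij)
  convert! this using 1
  ext ⟨i, hi⟩ k
  fin_cases i <;> simp at hi ⊢

/-- The linear map with given images of the coordinate vectors. -/
noncomputable def _root_.planeMap (u w : Plane) : Plane →ₗ[ℝ] Plane :=
  Matrix.toLpLin 2 2 !![u 0, w 0; u 1, w 1]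

theorem _root_.planeMap_apply (u w x : Plane) : planeMap u w x = x 0 • u + x 1 • w := by
  ext i
  fin_cases i <;> simp [planeMap, Matrix.toLpLin_apply, dotProduct, mul_comm]

theorem _root_.planeMap_det (u w : Plane) : LinearMap.det (planeMap u w) = planeCross u w := by
  rw [planeMap, Matrix.toLpLin_eq_toLin, LinearMap.det_toLin, Matrix.det_fin_two_of, planeCross]
  ring

/-- The reference triangle. -/
noncomputable def reference : MarkedTriangle :=
  ⟨0, EuclideanSpace.single 0 1, EuclideanSpace.single 1 1⟩

/-- The triangle is an affine image of the reference triangle, with determinant `T.cross`. The area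
of the reference triangle is never evaluated; only its positivity matters. -/
theorem area_eq (T : MarkedTriangle) : T.area = reference.area * |T.cross| := by
  have h : T.carrier = (fun x => T.apex + x) ''
      (planeMap (T.left - T.apex) (T.right - T.apex) '' reference.carrier) := by
    rw [carrier, carrier, LinearMap.image_convexHull]
    rw [show (fun x => T.apex + x) = (AffineEquiv.constVAdd ℝ Plane T.apex : Plane →ᵃ[ℝ] Plane) from
      rfl, AffineMap.image_convexHull]
    congr 1
    simp [vertices, reference, Set.image_insert_eq, planeMap_apply]
  rw [area, h, Measure.real, Set.image_add_left, measure_preimage_add,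
    Measure.addHaar_image_linearMap, planeMap_det, ENNReal.toReal_mul,
    ENNReal.toReal_ofReal (abs_nonneg _), mul_comm]
  rfl

theorem Nondegenerate.area_pos {T : MarkedTriangle} (h : T.Nondegenerate) : 0 < T.area := by
  rw [area, Measure.real]
  refine ENNReal.toReal_pos ?_ T.isCompact_carrier.measure_lt_top.ne
  exact ((isOpen_interior.measure_pos volume h.interior_nonempty).trans_le
    (measure_mono interior_subset)).ne'

theorem reference_area_pos : 0 < reference.area := by
  apply Nondegenerate.area_pos
  apply nondegenerate_of_cross_ne_zero
  simp [cross, planeCross, reference]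

theorem Nondegenerate.cross_ne_zero {T : MarkedTriangle} (h : T.Nondegenerate) : T.cross ≠ 0 := by
  intro h0
  have := h.area_pos
  rw [area_eq, h0] at this
  simp at this

theorem Nondegenerate.child₁ {T : MarkedTriangle} (h : T.Nondegenerate) :
    T.child₁.Nondegenerate := by
  apply nondegenerate_of_cross_ne_zero
  rw [cross_child₁]
  exact div_ne_zero h.cross_ne_zero two_ne_zero

theorem Nondegenerate.child₂ {T : MarkedTriangle} (h : T.Nondegenerate) :
    T.child₂.Nondegenerate := by
  apply nondegenerate_of_cross_ne_zero
  rw [cross_child₂]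
  exact div_ne_zero h.cross_ne_zero two_ne_zero

theorem area_child₁ (T : MarkedTriangle) : T.child₁.area = T.area / 2 := by
  rw [area_eq, area_eq T, cross_child₁, abs_div, abs_two]
  ring

theorem area_child₂ (T : MarkedTriangle) : T.child₂.area = T.area / 2 := by
  rw [area_eq, area_eq T, cross_child₂, abs_div, abs_two]
  ring

theorem dist_vertex_sq_le (T : MarkedTriangle) : ∀ x ∈ T.vertices, ∀ y ∈ T.vertices,
    dist x y ^ 2 ≤ 2 * T.sumSq := by
  intro x hx y hy
  simp only [vertices, Set.mem_insert_iff, Set.mem_singleton_iff] at hx hy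
  rcases hx with rfl | rfl | rfl <;> rcases hy with rfl | rfl | rfl <;>
  · simp only [dist_eq_norm, sumSq, Plane.norm_sq, PiLp.sub_apply]
    nlinarith [sq_nonneg (T.left 0 - T.apex 0), sq_nonneg (T.left 1 - T.apex 1),
      sq_nonneg (T.right 0 - T.apex 0), sq_nonneg (T.right 1 - T.apex 1),
      sq_nonneg (T.left 0 - T.apex 0 + (T.right 0 - T.apex 0)),
      sq_nonneg (T.left 1 - T.apex 1 + (T.right 1 - T.apex 1))]

theorem diam_sq_le (T : MarkedTriangle) : Metric.diam T.carrier ^ 2 ≤ 2 * T.sumSq := by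
  have h0 : 0 ≤ 2 * T.sumSq := by unfold sumSq; positivity
  rw [carrier, convexHull_diam]
  have : Metric.diam T.vertices ≤ Real.sqrt (2 * T.sumSq) :=
    Metric.diam_le_of_forall_dist_le (Real.sqrt_nonneg _) fun x hx y hy =>
      Real.le_sqrt_of_sq_le (T.dist_vertex_sq_le x hx y hy)
  calc _ ≤ Real.sqrt (2 * T.sumSq) ^ 2 := by gcongr
    _ = _ := Real.sq_sqrt h0

theorem dist_le_diam (T : MarkedTriangle) {x y : Plane} (hx : x ∈ T.carrier) (hy : y ∈ T.carrier) :
    dist x y ≤ Metric.diam T.carrier :=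
  Metric.dist_le_diam_of_mem T.isCompact_carrier.isBounded hx hy

theorem sumSq_le (T : MarkedTriangle) : T.sumSq ≤ 2 * Metric.diam T.carrier ^ 2 := by
  have h1 := T.dist_le_diam T.left_mem_carrier T.apex_mem_carrier
  have h2 := T.dist_le_diam T.right_mem_carrier T.apex_mem_carrier
  rw [dist_eq_norm] at h1 h2
  have h1' := pow_le_pow_left₀ (norm_nonneg _) h1 2
  have h2' := pow_le_pow_left₀ (norm_nonneg _) h2 2
  unfold sumSq
  linarith

theorem _root_.abs_planeCross_le (u w : Plane) : |planeCross u w| ≤ ‖u‖ * ‖w‖ := by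
  apply abs_le_of_sq_le_sq _ (by positivity)
  rw [mul_pow, Plane.norm_sq, Plane.norm_sq, planeCross]
  nlinarith [sq_nonneg (u 0 * w 0 + u 1 * w 1)]

theorem cross_eq (T : MarkedTriangle) (i : Fin 3) : T.cross =
    planeCross (T.vert (i + 2) - T.vert (i + 1)) (T.vert i - T.vert (i + 1)) := by
  fin_cases i <;> simp [cross, planeCross] <;> try ring

/-- Each edge is bounded below by the area divided by the diameter. -/
theorem abs_cross_le (T : MarkedTriangle) (i : Fin 3) :
    |T.cross| ≤ dist (T.vert (i + 1)) (T.vert (i + 2)) * Metric.diam T.carrier := by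
  rw [T.cross_eq i]
  refine (abs_planeCross_le _ _).trans ?_
  rw [dist_comm, dist_eq_norm]
  gcongr
  rw [← dist_eq_norm]
  exact T.dist_le_diam (T.vert_mem_carrier _) (T.vert_mem_carrier _)

end MarkedTriangle

/-! ### Triangles generated by repeated bisection. -/

namespace MarkedTriangle

/-- The triangles obtained from `P` by repeated bisection. -/
inductive IsDescendant (P : MarkedTriangle) : MarkedTriangle → Prop
  | refl : IsDescendant P P
  | child₁ (S : MarkedTriangle) : IsDescendant P S → IsDescendant P S.child₁
  | child₂ (S : MarkedTriangle) : IsDescendant P S → IsDescendant P S.child₂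

theorem mid_mem_openSegment (T : MarkedTriangle) : T.mid ∈ openSegment ℝ T.left T.right :=
  ⟨1 / 2, 1 / 2, by norm_num, by norm_num, by norm_num, by
    rw [mid, midpoint_eq_smul_add, smul_add, invOf_eq_inv, one_div]⟩

theorem mid_mem_carrier (T : MarkedTriangle) : T.mid ∈ T.carrier :=
  T.convex_carrier.openSegment_subset T.left_mem_carrier T.right_mem_carrier T.mid_mem_openSegment

theorem child₁_carrier_subset (T : MarkedTriangle) : T.child₁.carrier ⊆ T.carrier := by
  apply convexHull_min _ T.convex_carrier
  rintro x (rfl | rfl | rfl)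
  exacts [T.mid_mem_carrier, T.apex_mem_carrier, T.left_mem_carrier]

theorem child₂_carrier_subset (T : MarkedTriangle) : T.child₂.carrier ⊆ T.carrier := by
  apply convexHull_min _ T.convex_carrier
  rintro x (rfl | rfl | rfl)
  exacts [T.mid_mem_carrier, T.right_mem_carrier, T.apex_mem_carrier]

namespace IsDescendant

theorem nondegenerate {P S : MarkedTriangle} (h : IsDescendant P S) (hP : P.Nondegenerate) :
    S.Nondegenerate := by
  induction h with
  | refl => exact hP
  | child₁ S _ ih => exact ih.child₁
  | child₂ S _ ih => exact ih.child₂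

theorem carrier_subset {P S : MarkedTriangle} (h : IsDescendant P S) : S.carrier ⊆ P.carrier := by
  induction h with
  | refl => exact subset_rfl
  | child₁ S _ ih => exact S.child₁_carrier_subset.trans ih
  | child₂ S _ ih => exact S.child₂_carrier_subset.trans ih

theorem trans {P S R : MarkedTriangle} (h : IsDescendant P S) (h' : IsDescendant S R) :
    IsDescendant P R := by
  induction h' with
  | refl => exact h
  | child₁ S _ ih => exact ih.child₁
  | child₂ S _ ih => exact ih.child₂

theorem eq_or_child {P S : MarkedTriangle} (h : IsDescendant P S) :
    S = P ∨ IsDescendant P.child₁ S ∨ IsDescendant P.child₂ S := by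
  induction h with
  | refl => exact Or.inl rfl
  | child₁ S _ ih =>
    rcases ih with rfl | h | h
    · exact Or.inr (Or.inl .refl)
    · exact Or.inr (Or.inl h.child₁)
    · exact Or.inr (Or.inr h.child₁)
  | child₂ S _ ih =>
    rcases ih with rfl | h | h
    · exact Or.inr (Or.inr .refl)
    · exact Or.inr (Or.inl h.child₂)
    · exact Or.inr (Or.inr h.child₂)

/-- Two descendants of the same triangle are nested, or separated by a bisection. -/
theorem nested_or_separated {R S E : MarkedTriangle} (hS : IsDescendant R S)
    (hE : IsDescendant R E) : IsDescendant S E ∨ IsDescendant E S ∨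
      ∃ P, IsDescendant R P ∧ ((IsDescendant P.child₁ S ∧ IsDescendant P.child₂ E) ∨
        (IsDescendant P.child₂ S ∧ IsDescendant P.child₁ E)) := by
  induction hS with
  | refl => exact Or.inl hE
  | child₁ S hS ih =>
    rcases ih with h | h | ⟨P, hP, h | h⟩
    · rcases h.eq_or_child with rfl | h | h
      · exact Or.inr (Or.inl (.child₁ _ .refl))
      · exact Or.inl h
      · exact Or.inr (Or.inr ⟨S, hS, Or.inl ⟨.refl, h⟩⟩)
    · exact Or.inr (Or.inl h.child₁)
    · exact Or.inr (Or.inr ⟨P, hP, Or.inl ⟨h.1.child₁, h.2⟩⟩)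
    · exact Or.inr (Or.inr ⟨P, hP, Or.inr ⟨h.1.child₁, h.2⟩⟩)
  | child₂ S hS ih =>
    rcases ih with h | h | ⟨P, hP, h | h⟩
    · rcases h.eq_or_child with rfl | h | h
      · exact Or.inr (Or.inl (.child₂ _ .refl))
      · exact Or.inr (Or.inr ⟨S, hS, Or.inr ⟨.refl, h⟩⟩)
      · exact Or.inl h
    · exact Or.inr (Or.inl h.child₂)
    · exact Or.inr (Or.inr ⟨P, hP, Or.inl ⟨h.1.child₂, h.2⟩⟩)
    · exact Or.inr (Or.inr ⟨P, hP, Or.inr ⟨h.1.child₂, h.2⟩⟩)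

theorem sumSq_mul_area {P S : MarkedTriangle} (h : IsDescendant P S) :
    S.sumSq * P.area = P.sumSq * S.area := by
  induction h with
  | refl => rfl
  | child₁ S _ ih => rw [sumSq_child₁, area_child₁]; linarith
  | child₂ S _ ih => rw [sumSq_child₂, area_child₂]; linarith

/-- Bisection preserves shape regularity up to a factor. -/
theorem diam_sq_le {P S : MarkedTriangle} (h : IsDescendant P S) (hP : P.Nondegenerate) {σ : ℝ}
    (hσ : Metric.diam P.carrier ^ 2 ≤ σ * P.area) :
    Metric.diam S.carrier ^ 2 ≤ 4 * σ * S.area := by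
  have h1 := h.sumSq_mul_area
  have h2 := S.diam_sq_le
  have h3 := P.sumSq_le
  have hPa := hP.area_pos
  have hSa := (h.nondegenerate hP).area_pos
  have h4 : S.sumSq * P.area ≤ (2 * (σ * P.area)) * S.area := by
    rw [h1]; gcongr; linarith
  have h5 : S.sumSq ≤ 2 * σ * S.area := by
    refine le_of_mul_le_mul_right (h4.trans_eq (by ring)) hPa
  linarith

end IsDescendant

/-! ### The two children of a triangle -/

theorem affine_map_mid (T : MarkedTriangle) (f : Plane →ᵃ[ℝ] ℝ) :
    f T.mid = (f T.left + f T.right) / 2 := by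
  rw [mid, AffineMap.map_midpoint, midpoint_eq_smul_add, invOf_eq_inv, smul_eq_mul]
  ring

/-- Together with `bary_child₂` this shows that the children lie on opposite sides of the median:
the coordinates vanishing on it are opposite to each other. -/
theorem Nondegenerate.bary_child₁ {T : MarkedTriangle} (h : T.Nondegenerate) (x : Plane) :
    h.child₁.bary 2 x = h.bary 1 x - h.bary 2 x := by
  rw [h.child₁.affine_apply (h.bary 1), h.child₁.affine_apply (h.bary 2)]
  simp only [MarkedTriangle.child₁]
  rw [affine_map_mid, affine_map_mid]
  have := h.bary_vert
  have e := fun i => this i 0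
  have e1 := fun i => this i 1
  have e2 := fun i => this i 2
  simp only [vert_zero, vert_one, vert_two] at e e1 e2
  simp [e, e1, e2]

theorem Nondegenerate.bary_child₂ {T : MarkedTriangle} (h : T.Nondegenerate) (x : Plane) :
    h.child₂.bary 1 x = h.bary 2 x - h.bary 1 x := by
  rw [h.child₂.affine_apply (h.bary 1), h.child₂.affine_apply (h.bary 2)]
  simp only [MarkedTriangle.child₂]
  rw [affine_map_mid, affine_map_mid]
  have := h.bary_vert
  have e := fun i => this i 0
  have e1 := fun i => this i 1
  have e2 := fun i => this i 2
  simp only [vert_zero, vert_one, vert_two] at e e1 e2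
  simp [e, e1, e2]

theorem Nondegenerate.disjoint_interior_children {T : MarkedTriangle} (h : T.Nondegenerate) :
    Disjoint (interior T.child₁.carrier) (interior T.child₂.carrier) := by
  rw [Set.disjoint_left]
  intro x h1 h2
  have h1' := h.child₁.mem_interior_iff.1 h1 2
  have h2' := h.child₂.mem_interior_iff.1 h2 1
  rw [h.bary_child₁] at h1'
  rw [h.bary_child₂] at h2'
  linarith

/-- Siblings thus meet the way two triangles of a conforming partition do, which lets
`halved_edge_subset_of_separated` treat both situations at once. -/
theorem Nondegenerate.child_inter_subset {T : MarkedTriangle} (h : T.Nondegenerate) :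
    T.child₁.carrier ∩ T.child₂.carrier ⊆
      convexHull ℝ (T.child₁.vertices ∩ T.child₂.vertices) := by
  rintro x ⟨h1, h2⟩
  have h1' := h.child₁.mem_carrier_iff.1 h1 2
  have h2' := h.child₂.mem_carrier_iff.1 h2 1
  have h0 : h.child₁.bary 2 x = 0 := by
    rw [h.bary_child₁] at *
    rw [h.bary_child₂] at h2'
    linarith
  have := h.child₁.mem_edge_of_bary h1 h0
  refine (convex_convexHull ℝ _).segment_subset ?_ ?_ this
  · apply subset_convexHull
    simp [MarkedTriangle.child₁, MarkedTriangle.child₂, vertices]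
  · apply subset_convexHull
    simp [MarkedTriangle.child₁, MarkedTriangle.child₂, vertices]

/-! ### Dyadic subsegments -/

/-- `[y, z]` is a dyadic subsegment of `[c, d]`. -/
def IsDyadic (c d y z : Plane) : Prop :=
  ∃ n k : ℕ, k + 1 ≤ 2 ^ n ∧
    ((y = AffineMap.lineMap c d ((k : ℝ) / 2 ^ n) ∧
        z = AffineMap.lineMap c d (((k : ℝ) + 1) / 2 ^ n)) ∨
      (z = AffineMap.lineMap c d ((k : ℝ) / 2 ^ n) ∧
        y = AffineMap.lineMap c d (((k : ℝ) + 1) / 2 ^ n)))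

namespace IsDyadic

theorem symm {c d y z : Plane} (h : IsDyadic c d y z) : IsDyadic c d z y := by
  obtain ⟨n, k, hk, h⟩ := h
  exact ⟨n, k, hk, h.symm⟩

theorem swap_base {c d y z : Plane} (h : IsDyadic c d y z) : IsDyadic d c y z := by
  obtain ⟨n, k, hk, h⟩ := h
  refine ⟨n, 2 ^ n - (k + 1), by omega, ?_⟩
  have e : ((2 ^ n - (k + 1) : ℕ) : ℝ) = 2 ^ n - (k + 1) := by
    rw [Nat.cast_sub hk]; push_cast; ring
  have hp : (2 : ℝ) ^ n ≠ 0 := by positivity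
  have e1 : ((2 ^ n - (k + 1) : ℕ) : ℝ) / 2 ^ n = 1 - ((k : ℝ) + 1) / 2 ^ n := by
    rw [e]; field_simp
  have e2 : (((2 ^ n - (k + 1) : ℕ) : ℝ) + 1) / 2 ^ n = 1 - (k : ℝ) / 2 ^ n := by
    rw [e]; field_simp; ring
  rw [e1, e2, AffineMap.lineMap_apply_one_sub, AffineMap.lineMap_apply_one_sub]
  rcases h with ⟨h1, h2⟩ | ⟨h1, h2⟩
  · exact Or.inr ⟨h2, h1⟩
  · exact Or.inl ⟨h2, h1⟩

theorem refl (c d : Plane) : IsDyadic c d c d := ⟨0, 0, by simp, Or.inl (by simp)⟩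

theorem midpoint_left {c d y z : Plane} (h : IsDyadic c d y z) :
    IsDyadic c d (midpoint ℝ y z) y := by
  obtain ⟨n, k, hk, ⟨rfl, rfl⟩ | ⟨rfl, rfl⟩⟩ := h
  · refine ⟨n + 1, 2 * k, by rw [pow_succ]; omega, Or.inr ⟨?_, ?_⟩⟩
    · congr 1; push_cast; rw [pow_succ]; field_simp
    · rw [← AffineMap.map_midpoint]
      congr 1; rw [midpoint_eq_smul_add]; push_cast; rw [pow_succ]; simp; field_simp; ring
  · refine ⟨n + 1, 2 * k + 1, by rw [pow_succ]; omega, Or.inl ⟨?_, ?_⟩⟩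
    · rw [← AffineMap.map_midpoint]
      congr 1; rw [midpoint_eq_smul_add]; push_cast; rw [pow_succ]; simp; field_simp; ring
    · congr 1; push_cast; rw [pow_succ]; field_simp; ring

/-- The midpoint of an interval of level `n` is a grid point of level `n + 1`, so it is not interior
to any interval of level above `n`. Hence `m ≤ n`, and the finer interval is contained in the
coarser one. -/
theorem _root_.dyadic_nested {i j n m : ℕ}
    (h1 : (j : ℝ) / 2 ^ m < ((i : ℝ) / 2 ^ n + ((i : ℝ) + 1) / 2 ^ n) / 2)
    (h2 : ((i : ℝ) / 2 ^ n + ((i : ℝ) + 1) / 2 ^ n) / 2 < ((j : ℝ) + 1) / 2 ^ m) :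
    (j : ℝ) / 2 ^ m ≤ (i : ℝ) / 2 ^ n ∧ ((i : ℝ) + 1) / 2 ^ n ≤ ((j : ℝ) + 1) / 2 ^ m := by
  have e : ((i : ℝ) / 2 ^ n + ((i : ℝ) + 1) / 2 ^ n) / 2 = (2 * i + 1 : ℝ) / (2 ^ (n + 1)) := by
    rw [pow_succ]; field_simp; ring
  rw [e, div_lt_div_iff₀ (by positivity) (by positivity)] at h1 h2
  have h1' : j * 2 ^ (n + 1) < (2 * i + 1) * 2 ^ m := by exact_mod_cast h1
  have h2' : (2 * i + 1) * 2 ^ m < (j + 1) * 2 ^ (n + 1) := by exact_mod_cast h2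
  rw [div_le_div_iff₀ (by positivity) (by positivity),
    div_le_div_iff₀ (by positivity) (by positivity)]
  suffices j * 2 ^ n ≤ i * 2 ^ m ∧ (i + 1) * 2 ^ m ≤ (j + 1) * 2 ^ n by exact_mod_cast this
  rcases le_or_gt m n with hmn | hmn
  · obtain ⟨q, rfl⟩ := Nat.exists_eq_add_of_le hmn
    have hpos : 0 < 2 ^ m := by positivity
    have a1 : (2 * (j * 2 ^ q)) * 2 ^ m < (2 * i + 1) * 2 ^ m := by
      calc _ = j * 2 ^ (m + q + 1) := by ring
        _ < _ := h1'
    have a2 : (2 * i + 1) * 2 ^ m < (2 * ((j + 1) * 2 ^ q)) * 2 ^ m := by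
      calc _ < _ := h2'
        _ = _ := by ring
    have b1 := Nat.lt_of_mul_lt_mul_right a1
    have b2 := Nat.lt_of_mul_lt_mul_right a2
    have c1 : j * 2 ^ q ≤ i := by omega
    have c2 : i + 1 ≤ (j + 1) * 2 ^ q := by omega
    constructor
    · calc _ = (j * 2 ^ q) * 2 ^ m := by ring
        _ ≤ _ := by gcongr
    · calc _ ≤ ((j + 1) * 2 ^ q) * 2 ^ m := by gcongr
        _ = _ := by ring
  · obtain ⟨q, rfl⟩ := Nat.exists_eq_add_of_le (Nat.succ_le_of_lt hmn)
    have a1 : j * 2 ^ (n + 1) < ((2 * i + 1) * 2 ^ q) * 2 ^ (n + 1) := by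
      calc _ < _ := h1'
        _ = _ := by rw [Nat.succ_eq_add_one, pow_add]; ring
    have a2 : ((2 * i + 1) * 2 ^ q) * 2 ^ (n + 1) < (j + 1) * 2 ^ (n + 1) := by
      calc _ = (2 * i + 1) * 2 ^ (n.succ + q) := by
            rw [Nat.succ_eq_add_one, pow_add _ (n + 1)]; ring
        _ < _ := h2'
    have b1 := Nat.lt_of_mul_lt_mul_right a1
    have b2 := Nat.lt_of_mul_lt_mul_right a2
    omega

theorem nested {c d y z a b : Plane} (hcd : c ≠ d) (h : IsDyadic c d y z) (h' : IsDyadic c d a b)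
    (hm : midpoint ℝ y z ∈ openSegment ℝ a b) : y ∈ segment ℝ a b ∧ z ∈ segment ℝ a b := by
  wlog hyz : ∃ n k : ℕ, y = AffineMap.lineMap c d ((k : ℝ) / 2 ^ n) ∧
        z = AffineMap.lineMap c d (((k : ℝ) + 1) / 2 ^ n) generalizing y z
  · have hs := h.symm
    obtain ⟨n, k, hk, h1 | h1⟩ := h
    · exact absurd ⟨n, k, h1⟩ hyz
    · exact (this hs (by rwa [midpoint_comm]) ⟨n, k, h1⟩).symm
  wlog hab : ∃ n k : ℕ, a = AffineMap.lineMap c d ((k : ℝ) / 2 ^ n) ∧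
        b = AffineMap.lineMap c d (((k : ℝ) + 1) / 2 ^ n) generalizing a b
  · have hs := h'.symm
    obtain ⟨n, k, hk, h1 | h1⟩ := h'
    · exact absurd ⟨n, k, h1⟩ hab
    · rw [segment_symm]
      exact this hs (by rwa [openSegment_symm]) ⟨n, k, h1⟩
  obtain ⟨n, i, rfl, rfl⟩ := hyz
  obtain ⟨m, j, rfl, rfl⟩ := hab
  rw [← AffineMap.map_midpoint, ← image_openSegment,
    (AffineMap.lineMap_injective ℝ hcd).mem_set_image,
    openSegment_eq_Ioo (by gcongr; linarith), midpoint_eq_smul_add, invOf_eq_inv, smul_eq_mul,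
    inv_mul_eq_div] at hm
  have := dyadic_nested hm.1 hm.2
  rw [← image_segment, (AffineMap.lineMap_injective ℝ hcd).mem_set_image,
    (AffineMap.lineMap_injective ℝ hcd).mem_set_image, segment_eq_Icc (by gcongr; linarith)]
  have e : (i : ℝ) / 2 ^ n ≤ ((i : ℝ) + 1) / 2 ^ n := by gcongr; linarith
  exact ⟨⟨this.1, e.trans this.2⟩, ⟨this.1.trans e, this.2⟩⟩

end IsDyadic

/-- The edges of a descendant of `P` that lie on an edge of `P` are dyadic. -/
theorem IsDescendant.isDyadic {P S : MarkedTriangle} (h : IsDescendant P S) (hP : P.Nondegenerate)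
    (i : Fin 3) : ∀ y ∈ S.vertices, ∀ z ∈ S.vertices, y ≠ z → hP.bary i y = 0 → hP.bary i z = 0 →
      IsDyadic (P.vert (i + 1)) (P.vert (i + 2)) y z := by
  -- A descendant has interior points, so it cannot have all its vertices on one edge of `P`.
  have flat : ∀ S, IsDescendant P S → hP.bary i S.apex = 0 → hP.bary i S.left = 0 →
      hP.bary i S.right = 0 → False := by
    intro S hS h0 h1 h2
    obtain ⟨x, hx⟩ := (hS.nondegenerate hP).interior_nonempty
    have := (hS.nondegenerate hP).affine_apply (hP.bary i) x
    rw [h0, h1, h2] at this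
    have := hP.mem_interior_iff.1 (interior_mono hS.carrier_subset hx) i
    simp_all
  -- A midpoint on an edge of `P` forces the halved edge onto it, since edges are extreme faces.
  have ends : ∀ S, IsDescendant P S → hP.bary i S.mid = 0 →
      hP.bary i S.left = 0 ∧ hP.bary i S.right = 0 := fun S hS h0 =>
    hP.bary_eq_zero_of_openSegment (hS.carrier_subset S.left_mem_carrier)
      (hS.carrier_subset S.right_mem_carrier) S.mid_mem_openSegment h0
  induction h with
  | refl =>
    intro y hy z hz hyz h1 h2
    obtain ⟨j, rfl⟩ := P.mem_vertices_iff.1 hy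
    obtain ⟨k, rfl⟩ := P.mem_vertices_iff.1 hz
    rw [hP.bary_vert] at h1 h2
    have hij : i ≠ j := by rintro rfl; simp at h1
    have hik : i ≠ k := by rintro rfl; simp at h2
    have hjk : j ≠ k := by rintro rfl; simp at hyz
    have : (j = i + 1 ∧ k = i + 2) ∨ (k = i + 1 ∧ j = i + 2) := by
      clear * - hij hik hjk
      revert i j k; decide
    rcases this with ⟨rfl, rfl⟩ | ⟨rfl, rfl⟩
    · exact .refl _ _
    · exact (IsDyadic.refl _ _).symm
  | child₁ S hS ih =>
    have hal : hP.bary i S.apex = 0 → hP.bary i S.left = 0 →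
        IsDyadic (P.vert (i + 1)) (P.vert (i + 2)) S.apex S.left := fun h1 h2 =>
      ih _ (S.vert_mem_vertices 0) _ (S.vert_mem_vertices 1)
        ((hS.nondegenerate hP).injective_vert.ne (by decide : (0 : Fin 3) ≠ 1)) h1 h2
    have hml : hP.bary i S.mid = 0 →
        IsDyadic (P.vert (i + 1)) (P.vert (i + 2)) S.mid S.left := fun h1 =>
      (ih _ (S.vert_mem_vertices 1) _ (S.vert_mem_vertices 2)
        ((hS.nondegenerate hP).injective_vert.ne (by decide : (1 : Fin 3) ≠ 2))
        (ends S hS h1).1 (ends S hS h1).2).midpoint_left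
    have hma : hP.bary i S.mid = 0 → hP.bary i S.apex = 0 → False := fun h1 h2 =>
      flat S hS h2 (ends S hS h1).1 (ends S hS h1).2
    rintro y (rfl | rfl | rfl) z (rfl | rfl | rfl) hyz h1 h2
    exacts [(hyz rfl).elim, (hma h1 h2).elim, hml h1, (hma h2 h1).elim, (hyz rfl).elim, hal h1 h2,
      (hml h2).symm, (hal h2 h1).symm, (hyz rfl).elim]
  | child₂ S hS ih =>
    have har : hP.bary i S.apex = 0 → hP.bary i S.right = 0 →
        IsDyadic (P.vert (i + 1)) (P.vert (i + 2)) S.apex S.right := fun h1 h2 =>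
      ih _ (S.vert_mem_vertices 0) _ (S.vert_mem_vertices 2)
        ((hS.nondegenerate hP).injective_vert.ne (by decide : (0 : Fin 3) ≠ 2)) h1 h2
    have hmr : hP.bary i S.mid = 0 →
        IsDyadic (P.vert (i + 1)) (P.vert (i + 2)) S.mid S.right := fun h1 => by
      have := (ih _ (S.vert_mem_vertices 2) _ (S.vert_mem_vertices 1)
        ((hS.nondegenerate hP).injective_vert.ne (by decide : (2 : Fin 3) ≠ 1))
        (ends S hS h1).2 (ends S hS h1).1).midpoint_left
      rwa [midpoint_comm] at this
    have hma : hP.bary i S.mid = 0 → hP.bary i S.apex = 0 → False := fun h1 h2 =>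
      flat S hS h2 (ends S hS h1).1 (ends S hS h1).2
    rintro y (rfl | rfl | rfl) z (rfl | rfl | rfl) hyz h1 h2
    exacts [(hyz rfl).elim, hmr h1, (hma h1 h2).elim, (hmr h2).symm, (hyz rfl).elim,
      (har h2 h1).symm, (hma h2 h1).elim, har h1 h2, (hyz rfl).elim]

/-- If the bisection of a descendant of `P₁` creates a point in the interior of an edge of a
descendant of `P₂`, it halves a part of that edge. -/
theorem halved_edge_subset_of_separated {P₁ P₂ S E : MarkedTriangle} (h₁ : P₁.Nondegenerate)
    (h₂ : P₂.Nondegenerate)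
    (hinter : P₁.carrier ∩ P₂.carrier ⊆ convexHull ℝ (P₁.vertices ∩ P₂.vertices))
    (hdisj : Disjoint (interior P₁.carrier) (interior P₂.carrier))
    (hS : IsDescendant P₁ S) (hE : IsDescendant P₂ E) (i : Fin 3)
    (hx : S.mid ∈ openSegment ℝ (E.vert (i + 1)) (E.vert (i + 2))) :
    S.left ∈ E.edge i ∧ S.right ∈ E.edge i := by
  have hSn := hS.nondegenerate h₁
  have hEn := hE.nondegenerate h₂
  have hl := hS.carrier_subset S.left_mem_carrier
  have hr := hS.carrier_subset S.right_mem_carrier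
  have hlr : S.left ≠ S.right := hSn.injective_vert.ne (by decide : (1 : Fin 3) ≠ 2)
  have hxf : S.mid ∈ convexHull ℝ (P₁.vertices ∩ P₂.vertices) :=
    hinter ⟨hS.carrier_subset S.mid_mem_carrier,
      hE.carrier_subset (E.edge_subset_carrier i (openSegment_subset_segment _ _ _ hx))⟩
  -- Disjointness of the interiors excludes that all three vertices are shared; the common part then
  -- lies in the edge of `P₁` opposite to the vertex `e`.
  obtain ⟨e, he⟩ : ∃ e, P₁.vert e ∉ P₂.vertices := by
    by_contra! hall
    have hsub : P₁.carrier ⊆ P₂.carrier := by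
      apply convexHull_mono
      intro y hy
      obtain ⟨j, rfl⟩ := P₁.mem_vertices_iff.1 hy
      exact hall j
    obtain ⟨y, hy⟩ := h₁.interior_nonempty
    exact Set.disjoint_left.1 hdisj hy (interior_mono hsub hy)
  have hcommon : P₁.vertices ∩ P₂.vertices ⊆ {P₁.vert (e + 1), P₁.vert (e + 2)} := by
    rintro y ⟨hy1, hy2⟩
    obtain ⟨j, rfl⟩ := P₁.mem_vertices_iff.1 hy1
    have hje : j ≠ e := by rintro rfl; exact he hy2
    have : j = e + 1 ∨ j = e + 2 := by
      clear * - hje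
      revert j e; decide
    rcases this with rfl | rfl <;> simp
  -- A midpoint is not an extreme point. The common part therefore is not a single vertex, and both
  -- ends of the edge are shared.
  have hvert : ∀ j, S.mid ≠ P₁.vert j := by
    intro j hj
    have hm := S.mid_mem_openSegment
    rw [hj] at hm
    have := h₁.eq_vert_of_openSegment hl hr hm
    exact hlr (this.1.trans this.2.symm)
  have hc : P₁.vert (e + 1) ∈ P₂.vertices := by
    by_contra hc
    have : P₁.vertices ∩ P₂.vertices ⊆ {P₁.vert (e + 2)} := by
      intro y hy
      rcases hcommon hy with rfl | rfl
      · exact (hc hy.2).elim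
      · rfl
    have := convexHull_mono this hxf
    rw [convexHull_singleton] at this
    exact hvert _ this
  have hd : P₁.vert (e + 2) ∈ P₂.vertices := by
    by_contra hd
    have : P₁.vertices ∩ P₂.vertices ⊆ {P₁.vert (e + 1)} := by
      intro y hy
      rcases hcommon hy with rfl | rfl
      · rfl
      · exact (hd hy.2).elim
    have := convexHull_mono this hxf
    rw [convexHull_singleton] at this
    exact hvert _ this
  have hcd : P₁.vert (e + 1) ≠ P₁.vert (e + 2) := h₁.injective_vert.ne (by simp)
  have hxe : S.mid ∈ segment ℝ (P₁.vert (e + 1)) (P₁.vert (e + 2)) := by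
    rw [← convexHull_pair]
    exact convexHull_mono hcommon hxf
  have h0 := h₁.bary_eq_zero_of_openSegment hl hr S.mid_mem_openSegment (h₁.bary_edge hxe)
  have hdyS := hS.isDyadic h₁ e _ (S.vert_mem_vertices 1) _ (S.vert_mem_vertices 2) hlr h0.1 h0.2
  obtain ⟨j, hj⟩ := P₂.mem_vertices_iff.1 hc
  obtain ⟨k, hk⟩ := P₂.mem_vertices_iff.1 hd
  have hjk : j ≠ k := by rintro rfl; exact hcd (hj.trans hk.symm)
  have hg : ∃ g : Fin 3, (j = g + 1 ∧ k = g + 2) ∨ (j = g + 2 ∧ k = g + 1) := by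
    clear * - hjk
    revert j k; decide
  obtain ⟨g, hg⟩ := hg
  have hxg : S.mid ∈ P₂.edge g := by
    rw [hj, hk] at hxe
    rcases hg with ⟨rfl, rfl⟩ | ⟨rfl, rfl⟩
    · exact hxe
    · rwa [segment_symm] at hxe
  have h0' := h₂.bary_eq_zero_of_openSegment (hE.carrier_subset (E.vert_mem_carrier _))
    (hE.carrier_subset (E.vert_mem_carrier _)) hx (h₂.bary_edge hxg)
  have hdyE := hE.isDyadic h₂ g _ (E.vert_mem_vertices (i + 1)) _ (E.vert_mem_vertices (i + 2))
    (hEn.injective_vert.ne (by simp)) h0'.1 h0'.2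
  -- The shared edge is edge `e` of `P₁` and edge `g` of `P₂`, possibly with reversed orientation;
  -- both dyadic families are now referred to the same parametrization.
  have hdyE' : IsDyadic (P₁.vert (e + 1)) (P₁.vert (e + 2)) (E.vert (i + 1)) (E.vert (i + 2)) := by
    rw [hj, hk]
    rcases hg with ⟨rfl, rfl⟩ | ⟨rfl, rfl⟩
    · exact hdyE
    · exact hdyE.swap_base
  exact hdyS.nested hcd hdyE' hx

/-- If `S` lies below `E`, the edge of `E` is an extreme face and absorbs the halved edge. If `E`
lies strictly below `S`, it is inside a child of `S`, where `S.mid` is a vertex and so cannot lie in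
an open edge. Otherwise some bisection separates the two, and its children are neighbours along an
edge. -/
theorem halved_edge_subset_of_descendant {R S E : MarkedTriangle} (hR : R.Nondegenerate)
    (hS : IsDescendant R S) (hE : IsDescendant R E) (i : Fin 3)
    (hx : S.mid ∈ openSegment ℝ (E.vert (i + 1)) (E.vert (i + 2))) :
    S.left ∈ E.edge i ∧ S.right ∈ E.edge i := by
  have hSn := hS.nondegenerate hR
  have hEn := hE.nondegenerate hR
  have below : IsDescendant E S → S.left ∈ E.edge i ∧ S.right ∈ E.edge i := by
    intro h
    have hl := h.carrier_subset S.left_mem_carrier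
    have hr := h.carrier_subset S.right_mem_carrier
    have h0 := hEn.bary_eq_zero_of_openSegment hl hr S.mid_mem_openSegment
      (hEn.bary_edge (openSegment_subset_segment _ _ _ hx))
    exact ⟨hEn.mem_edge_of_bary hl h0.1, hEn.mem_edge_of_bary hr h0.2⟩
  have extreme : ∀ C : MarkedTriangle, C.Nondegenerate → C.vert 0 = S.mid → IsDescendant C E →
      False := by
    intro C hC hCm h
    rw [← hCm] at hx
    have := hC.eq_vert_of_openSegment (h.carrier_subset (E.vert_mem_carrier _))
      (h.carrier_subset (E.vert_mem_carrier _)) hx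
    exact hEn.injective_vert.ne (by simp : i + 1 ≠ i + 2) (this.1.trans this.2.symm)
  rcases hS.nested_or_separated hE with h | h | ⟨P, hP, ⟨h1, h2⟩ | ⟨h1, h2⟩⟩
  · rcases h.eq_or_child with rfl | h | h
    · exact below .refl
    · exact (extreme _ hSn.child₁ rfl h).elim
    · exact (extreme _ hSn.child₂ rfl h).elim
  · exact below h
  · have hPn := hP.nondegenerate hR
    exact halved_edge_subset_of_separated hPn.child₁ hPn.child₂ hPn.child_inter_subset
      hPn.disjoint_interior_children h1 h2 i hx
  · have hPn := hP.nondegenerate hR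
    refine halved_edge_subset_of_separated hPn.child₂ hPn.child₁ ?_
      hPn.disjoint_interior_children.symm h1 h2 i hx
    rw [Set.inter_comm, Set.inter_comm P.child₂.vertices]
    exact hPn.child_inter_subset

end MarkedTriangle

open MarkedTriangle

/-! ### The bisection forest, null boundaries and edge lengths. -/

namespace MarkedTriangle

theorem inBisectionTree_iff {T₀ : Finset MarkedTriangle} {S : MarkedTriangle} :
    InBisectionTree T₀ S ↔ ∃ R ∈ T₀, IsDescendant R S := by
  constructor
  · intro h
    induction h with
    | root T hT => exact ⟨T, hT, .refl⟩
    | child₁ T _ ih =>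
      obtain ⟨R, hR, h⟩ := ih
      exact ⟨R, hR, h.child₁⟩
    | child₂ T _ ih =>
      obtain ⟨R, hR, h⟩ := ih
      exact ⟨R, hR, h.child₂⟩
  · rintro ⟨R, hR, h⟩
    induction h with
    | refl => exact .root R hR
    | child₁ S _ ih => exact .child₁ S ih
    | child₂ S _ ih => exact .child₂ S ih

theorem volume_frontier (E : MarkedTriangle) : volume (frontier E.carrier) = 0 :=
  E.convex_carrier.addHaar_frontier volume

theorem aedisjoint_carrier {S E : MarkedTriangle}
    (h : Disjoint (interior S.carrier) (interior E.carrier)) :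
    AEDisjoint volume S.carrier E.carrier := by
  refine measure_mono_null (t := frontier S.carrier ∪ frontier E.carrier) ?_
    (measure_union_null S.volume_frontier E.volume_frontier)
  rintro x ⟨hS, hE⟩
  rw [S.isClosed_carrier.frontier_eq, E.isClosed_carrier.frontier_eq]
  by_cases hx : x ∈ interior S.carrier
  · exact Or.inr ⟨hE, fun hx' => Set.disjoint_left.1 h hx hx'⟩
  · exact Or.inl ⟨hS, hx⟩

theorem Nondegenerate.eq_of_mem_edge {T : MarkedTriangle} (h : T.Nondegenerate) {i : Fin 3}
    {x : Plane} (hx : x ∈ T.edge i) (hv : x ∈ T.vertices) :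
    x = T.vert (i + 1) ∨ x = T.vert (i + 2) := by
  obtain ⟨j, rfl⟩ := T.mem_vertices_iff.1 hv
  have h0 := h.bary_edge hx
  rw [h.bary_vert] at h0
  have hij : i ≠ j := by rintro rfl; simp at h0
  have : j = i + 1 ∨ j = i + 2 := by
    clear * - hij
    revert i j; decide
  rcases this with rfl | rfl <;> simp

theorem Nondegenerate.diam_pos {T : MarkedTriangle} (h : T.Nondegenerate) :
    0 < Metric.diam T.carrier := by
  have h1 := T.abs_cross_le 0
  have h2 := abs_pos.2 h.cross_ne_zero
  by_contra! h3
  have : dist (T.vert (0 + 1)) (T.vert (0 + 2)) * Metric.diam T.carrier ≤ 0 :=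
    mul_nonpos_of_nonneg_of_nonpos dist_nonneg h3
  linarith

end MarkedTriangle

/-! ### Geometry of admissible refinements: grids on the edges and bounded overlap. -/

section Mesh

variable {Ω : Set Plane} {T₀ T : Finset MarkedTriangle}

theorem IsConformingPartition.nondegenerate_of_tree (hT₀ : IsConformingPartition Ω T₀)
    {S : MarkedTriangle} (hS : InBisectionTree T₀ S) : S.Nondegenerate := by
  obtain ⟨R, hR, h⟩ := inBisectionTree_iff.1 hS
  exact h.nondegenerate (hT₀.nondegenerate R hR)

theorem IsConformingPartition.carrier_subset_of_tree (hT₀ : IsConformingPartition Ω T₀)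
    {S : MarkedTriangle} (hS : InBisectionTree T₀ S) : S.carrier ⊆ closure Ω := by
  obtain ⟨R, hR, h⟩ := inBisectionTree_iff.1 hS
  rw [← hT₀.cover]
  exact h.carrier_subset.trans (Set.subset_biUnion_of_mem (u := fun T => T.carrier) hR)

theorem IsConformingPartition.halved_edge_subset (hT₀ : IsConformingPartition Ω T₀)
    {S E : MarkedTriangle} (hS : InBisectionTree T₀ S) (hE : InBisectionTree T₀ E) (i : Fin 3)
    (hx : S.mid ∈ openSegment ℝ (E.vert (i + 1)) (E.vert (i + 2))) :
    S.left ∈ E.edge i ∧ S.right ∈ E.edge i := by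
  obtain ⟨R, hR, hS⟩ := inBisectionTree_iff.1 hS
  obtain ⟨R', hR', hE⟩ := inBisectionTree_iff.1 hE
  rcases eq_or_ne R R' with rfl | hne
  · exact halved_edge_subset_of_descendant (hT₀.nondegenerate R hR) hS hE i hx
  · exact halved_edge_subset_of_separated (hT₀.nondegenerate R hR) (hT₀.nondegenerate R' hR')
      (hT₀.conforming R hR R' hR' hne).subset (hT₀.nonoverlapping R hR R' hR' hne) hS hE i hx

theorem IsRefinement.inBisectionTree (h : IsRefinement T₀ T) :
    ∀ E ∈ T, InBisectionTree T₀ E := by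
  induction h with
  | refl => exact fun E hE => .root E hE
  | tail _ hstep ih =>
    obtain ⟨F, hF, rfl⟩ := hstep
    intro E hE
    simp only [Finset.mem_union, Finset.mem_erase, Finset.mem_insert, Finset.mem_singleton] at hE
    rcases hE with hE | rfl | rfl
    · exact ih E hE.2
    · exact .child₁ F (ih F hF)
    · exact .child₂ F (ih F hF)

theorem IsRefinement.disjoint_interior (hT₀ : IsConformingPartition Ω T₀)
    (h : IsRefinement T₀ T) : ∀ S ∈ T, ∀ E ∈ T, S ≠ E →
      Disjoint (interior S.carrier) (interior E.carrier) := by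
  induction h with
  | refl => exact hT₀.nonoverlapping
  | @tail b c hb hstep ih =>
    obtain ⟨F, hF, rfl⟩ := hstep
    have hFn := hT₀.nondegenerate_of_tree (IsRefinement.inBisectionTree hb F hF)
    have hF₁ := interior_mono F.child₁_carrier_subset
    have hF₂ := interior_mono F.child₂_carrier_subset
    intro S hS E hE hne
    simp only [Finset.mem_union, Finset.mem_erase, Finset.mem_insert, Finset.mem_singleton] at hS hE
    rcases hS with hS | rfl | rfl <;> rcases hE with hE | rfl | rfl
    · exact ih S hS.2 E hE.2 hne
    · exact (ih S hS.2 F hF hS.1).mono_right hF₁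
    · exact (ih S hS.2 F hF hS.1).mono_right hF₂
    · exact (ih F hF E hE.2 hE.1.symm).mono_left hF₁
    · exact (hne rfl).elim
    · exact hFn.disjoint_interior_children
    · exact (ih F hF E hE.2 hE.1.symm).mono_left hF₂
    · exact hFn.disjoint_interior_children.symm
    · exact (hne rfl).elim

theorem IsRefinement.nondegenerate (hT₀ : IsConformingPartition Ω T₀) (h : IsRefinement T₀ T)
    {E : MarkedTriangle} (hE : E ∈ T) : E.Nondegenerate :=
  hT₀.nondegenerate_of_tree (h.inBisectionTree E hE)

theorem IsRefinement.diam_sq_le (hT₀ : IsConformingPartition Ω T₀) (h : IsRefinement T₀ T) {σ : ℝ}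
    (hσ : IsShapeRegular σ T₀) {E : MarkedTriangle} (hE : E ∈ T) :
    Metric.diam E.carrier ^ 2 ≤ 4 * σ * E.area := by
  obtain ⟨R, hR, h⟩ := inBisectionTree_iff.1 (h.inBisectionTree E hE)
  exact h.diam_sq_le (hT₀.nondegenerate R hR) (hσ R hR)

/-- A hanging node lies in the interior of an edge of an element. -/
theorem IsRefinement.exists_openSegment_of_hanging (hT₀ : IsConformingPartition Ω T₀)
    (h : IsRefinement T₀ T) {x : Plane} (hx : x ∈ hangingNodes T) :
    ∃ E ∈ T, ∃ i, x ∈ openSegment ℝ (E.vert (i + 1)) (E.vert (i + 2)) := by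
  obtain ⟨⟨F, hF, hxF⟩, hx⟩ := hx
  obtain ⟨E, hE, hxE, hxv⟩ : ∃ E ∈ T, x ∈ E.carrier ∧ x ∉ E.vertices := by
    by_contra! hall
    exact hx ⟨⟨F, hF, hxF⟩, hall⟩
  refine ⟨E, hE, (h.nondegenerate hT₀ hE).exists_openSegment ?_ hxv⟩
  rw [E.isClosed_carrier.frontier_eq]
  refine ⟨hxE, fun hxi => ?_⟩
  have hne : F ≠ E := by rintro rfl; exact hxv hxF
  -- A vertex of `F` is a limit of interior points of `F`; if it were interior to `E`, the interiors
  -- of `E` and `F` would meet.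
  have hcl : x ∈ closure (interior F.carrier) := by
    rw [F.convex_carrier.closure_interior_eq_closure_of_nonempty_interior
      (h.nondegenerate hT₀ hF).interior_nonempty]
    exact subset_closure (F.vertices_subset_carrier hxF)
  obtain ⟨y, hy, hy'⟩ := mem_closure_iff.1 hcl _ isOpen_interior hxi
  exact Set.disjoint_left.1 (h.disjoint_interior hT₀ F hF E hE hne) hy' hy

/-- On each edge of an element, the nodes of index at most `n` sit on the grid with `2 ^ n`
intervals. -/
theorem HasGlobalIndex.mem_grid (hT₀ : IsConformingPartition Ω T₀) (h : IsRefinement T₀ T)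
    {x : Plane} {n : ℕ} (hx : HasGlobalIndex T₀ T x n) : ∀ E ∈ T, ∀ i, x ∈ E.edge i →
      ∃ k : ℕ, k ≤ 2 ^ n ∧
        x = AffineMap.lineMap (E.vert (i + 1)) (E.vert (i + 2)) ((k : ℝ) / 2 ^ n) := by
  -- The ends of an edge belong to every grid. This also covers a hanging node seen from an element
  -- of which it is a vertex.
  have atVertex : ∀ E ∈ T, ∀ (i : Fin 3) (x : Plane) (n : ℕ), x ∈ E.edge i → x ∈ E.vertices →
      ∃ k : ℕ, k ≤ 2 ^ n ∧
        x = AffineMap.lineMap (E.vert (i + 1)) (E.vert (i + 2)) ((k : ℝ) / 2 ^ n) := by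
    intro E hE i x n hxi hxv
    rcases (h.nondegenerate hT₀ hE).eq_of_mem_edge hxi hxv with rfl | rfl
    · exact ⟨0, Nat.zero_le _, by simp⟩
    · exact ⟨2 ^ n, le_rfl, by simp⟩
  induction hx with
  | proper x hx =>
    intro E hE i hxi
    exact atVertex E hE i x 0 hxi (hx.2 E hE (E.edge_subset_carrier i hxi))
  | hanging x S m n hx hS hmid _ _ ih₁ ih₂ =>
    intro E hE i hxi
    by_cases hxv : x ∈ E.vertices
    · exact atVertex E hE i x _ hxi hxv
    have ho : x ∈ openSegment ℝ (E.vert (i + 1)) (E.vert (i + 2)) := by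
      refine mem_openSegment_of_ne_left_right ?_ ?_ hxi
      · rintro rfl; exact hxv (E.vert_mem_vertices _)
      · rintro rfl; exact hxv (E.vert_mem_vertices _)
    subst hmid
    obtain ⟨hl, hr⟩ := hT₀.halved_edge_subset hS (h.inBisectionTree E hE) i ho
    obtain ⟨k, hk, hkl⟩ := ih₁ E hE i hl
    obtain ⟨l, hl, hlr⟩ := ih₂ E hE i hr
    obtain ⟨p, hp⟩ := Nat.exists_eq_add_of_le (le_max_left m n)
    obtain ⟨q, hq⟩ := Nat.exists_eq_add_of_le (le_max_right m n)
    -- Both endpoints lie on the grid with `2 ^ max m n` intervals; taking the midpoint adds the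
    -- numerators and doubles the denominator.
    refine ⟨k * 2 ^ p + l * 2 ^ q, ?_, ?_⟩
    · calc k * 2 ^ p + l * 2 ^ q ≤ 2 ^ m * 2 ^ p + 2 ^ n * 2 ^ q := by gcongr
        _ = _ := by rw [← pow_add, ← pow_add, ← hp, ← hq, pow_succ]; ring
    · rw [mid, hkl, hlr, ← AffineMap.map_midpoint]
      congr 1
      have e1 : (k : ℝ) / 2 ^ m = k * 2 ^ p / 2 ^ (max m n) := by rw [hp, pow_add]; field_simp
      have e2 : (l : ℝ) / 2 ^ n = l * 2 ^ q / 2 ^ (max m n) := by rw [hq, pow_add]; field_simp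
      rw [e1, e2, midpoint_eq_smul_add, pow_succ]
      push_cast
      simp
      field_simp

theorem IsAdmissible.mem_grid {Λ : ℕ} (hT₀ : IsConformingPartition Ω T₀) (h : IsRefinement T₀ T)
    (hΛ : IsAdmissible T₀ Λ T) {E : MarkedTriangle} (hE : E ∈ T) {x : Plane} (hx : x ∈ nodes T)
    {i : Fin 3} (hxi : x ∈ E.edge i) : ∃ k : ℕ, k ≤ 2 ^ Λ ∧
      x = AffineMap.lineMap (E.vert (i + 1)) (E.vert (i + 2)) ((k : ℝ) / 2 ^ Λ) := by
  obtain ⟨n, hn, hnΛ⟩ := hΛ x hx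
  obtain ⟨k, hk, hkx⟩ := hn.mem_grid hT₀ h E hE i hxi
  obtain ⟨p, rfl⟩ := Nat.exists_eq_add_of_le hnΛ
  refine ⟨k * 2 ^ p, ?_, ?_⟩
  · rw [pow_add]; gcongr
  · rw [hkx]; congr 1; rw [pow_add]; push_cast; field_simp

theorem vertices_subset_nodes {E : MarkedTriangle} (hE : E ∈ T) : E.vertices ⊆ nodes T :=
  fun _ hx => ⟨E, hE, hx⟩

theorem IsRefinement.vert_mem_nodesOn (hT₀ : IsConformingPartition Ω T₀) (h : IsRefinement T₀ T)
    {E : MarkedTriangle} (hE : E ∈ T) (i : Fin 3) : E.vert i ∈ nodesOn T E := by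
  refine ⟨vertices_subset_nodes hE (E.vert_mem_vertices i), ?_⟩
  apply (h.nondegenerate hT₀ hE).edge_subset_frontier (i + 1 + 1)
  have e : i = i + 1 + 1 + 1 := by clear * -; revert i; decide
  rw [edge, ← e]
  exact left_mem_segment ℝ _ _

theorem finite_nodes (T : Finset MarkedTriangle) : (nodes T).Finite := by
  have : nodes T = ⋃ E ∈ T, E.vertices := by ext; simp [nodes]
  rw [this]
  exact T.finite_toSet.biUnion fun E _ => by unfold vertices; exact Set.toFinite _

/-- Each of the three edges carries at most `2 ^ Λ + 1` grid points; the corners are counted twice.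
-/
theorem IsAdmissible.ncard_nodesOn_le {Λ : ℕ} (hT₀ : IsConformingPartition Ω T₀)
    (h : IsRefinement T₀ T) (hΛ : IsAdmissible T₀ Λ T) {E : MarkedTriangle} (hE : E ∈ T) :
    (nodesOn T E).ncard ≤ 3 * (2 ^ Λ + 1) := by
  set f : Fin 3 × Fin (2 ^ Λ + 1) → Plane := fun a =>
    AffineMap.lineMap (E.vert (a.1 + 1)) (E.vert (a.1 + 2)) ((a.2 : ℝ) / 2 ^ Λ)
  have hsub : nodesOn T E ⊆ Set.range f := by
    rintro x ⟨hx, hxE⟩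
    obtain ⟨i, hi⟩ := (h.nondegenerate hT₀ hE).exists_edge_of_mem_frontier hxE
    obtain ⟨k, hk, hkx⟩ := hΛ.mem_grid hT₀ h hE hx hi
    exact ⟨(i, ⟨k, by omega⟩), hkx.symm⟩
  calc (nodesOn T E).ncard ≤ (Set.range f).ncard := Set.ncard_le_ncard hsub (Set.finite_range f)
    _ ≤ Nat.card (Fin 3 × Fin (2 ^ Λ + 1)) := by
      rw [← Set.image_univ, ← Set.ncard_univ]
      exact Set.ncard_image_le Set.finite_univ
    _ = _ := by simp

/-- The other end is the next grid point that is a node. It exists because `b` is a node, and it is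
at least one grid step away. -/
theorem exists_isEdge_of_grid {E : MarkedTriangle} {a b : Plane} (hab : a ≠ b)
    (hfr : segment ℝ a b ⊆ frontier E.carrier) (hb : b ∈ nodesOn T E) {N : ℕ} (hN : 0 < N)
    (hgrid : ∀ x ∈ nodesOn T E, x ∈ segment ℝ a b →
      ∃ k : ℕ, k ≤ N ∧ x = AffineMap.lineMap a b ((k : ℝ) / N))
    {k : ℕ} (hk : k < N) (hp : AffineMap.lineMap a b ((k : ℝ) / N) ∈ nodesOn T E) :
    ∃ q ∈ segment ℝ a b, IsEdge T E (AffineMap.lineMap a b ((k : ℝ) / N)) q ∧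
      dist a b ≤ N * dist (AffineMap.lineMap a b ((k : ℝ) / N)) q := by
  classical
  have hN' : (0 : ℝ) < N := by exact_mod_cast hN
  have hex : ∃ l : ℕ, k < l ∧ l ≤ N ∧ AffineMap.lineMap a b ((l : ℝ) / N) ∈ nodesOn T E :=
    ⟨N, hk, le_rfl, by rwa [div_self hN'.ne', AffineMap.lineMap_apply_one]⟩
  obtain ⟨hkl, hlN, hl⟩ := Nat.find_spec hex
  have hmin := fun m => Nat.find_min hex (m := m)
  set l := Nat.find hex
  have hinj := AffineMap.lineMap_injective ℝ hab
  have hkl' : (k : ℝ) / N < (l : ℝ) / N := by gcongr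
  have hseg : ∀ m : ℕ, m ≤ N → AffineMap.lineMap a b ((m : ℝ) / N) ∈ segment ℝ a b := by
    intro m hm
    rw [segment_eq_image_lineMap]
    refine ⟨_, ⟨by positivity, ?_⟩, rfl⟩
    rw [div_le_one hN']
    exact_mod_cast hm
  have hsub : segment ℝ (AffineMap.lineMap a b ((k : ℝ) / N) : Plane)
      (AffineMap.lineMap a b ((l : ℝ) / N)) ⊆ segment ℝ a b :=
    (convex_segment a b).segment_subset (hseg k hk.le) (hseg l hlN)
  refine ⟨AffineMap.lineMap a b ((l : ℝ) / N), hseg l hlN,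
    ⟨hp, hl, fun he => hkl'.ne (hinj he), hsub.trans hfr, ?_⟩, ?_⟩
  · intro z hz hzo
    obtain ⟨m, hm, rfl⟩ := hgrid z hz (hsub (openSegment_subset_segment _ _ _ hzo))
    rw [← image_openSegment, hinj.mem_set_image, openSegment_eq_Ioo hkl'] at hzo
    have h1 : k < m := by
      have := (div_lt_div_iff_of_pos_right hN').1 hzo.1
      exact_mod_cast this
    have h2 : m < l := by
      have := (div_lt_div_iff_of_pos_right hN').1 hzo.2
      exact_mod_cast this
    exact hmin m h2 ⟨h1, hm, hz⟩
  · rw [dist_lineMap_lineMap, Real.dist_eq, abs_sub_comm, abs_of_pos (sub_pos.2 hkl'), ← sub_div,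
      ← mul_assoc, mul_div_cancel₀ _ hN'.ne']
    have : (k : ℝ) + 1 ≤ l := by exact_mod_cast hkl
    nlinarith [dist_nonneg (x := a) (y := b)]

/-- From each node on the boundary of an element starts an edge whose length is bounded below. -/
theorem IsAdmissible.exists_isEdge {Λ : ℕ} (hT₀ : IsConformingPartition Ω T₀)
    (h : IsRefinement T₀ T) (hΛ : IsAdmissible T₀ Λ T) {E : MarkedTriangle} (hE : E ∈ T)
    {p : Plane} (hp : p ∈ nodesOn T E) : ∃ (q : Plane) (i : Fin 3), p ∈ E.edge i ∧ q ∈ E.edge i ∧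
      IsEdge T E p q ∧ |E.cross| ≤ 2 ^ Λ * dist p q * Metric.diam E.carrier := by
  have hn := h.nondegenerate hT₀ hE
  obtain ⟨i, hi⟩ := hn.exists_edge_of_mem_frontier hp.2
  obtain ⟨k, hk, rfl⟩ := hΛ.mem_grid hT₀ h hE hp.1 hi
  have hne : E.vert (i + 1) ≠ E.vert (i + 2) := hn.injective_vert.ne (by simp)
  have hcast : ((2 ^ Λ : ℕ) : ℝ) = 2 ^ Λ := by push_cast; rfl
  have hgrid : ∀ x ∈ nodesOn T E, x ∈ segment ℝ (E.vert (i + 1)) (E.vert (i + 2)) →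
      ∃ k : ℕ, k ≤ 2 ^ Λ ∧
        x = AffineMap.lineMap (E.vert (i + 1)) (E.vert (i + 2)) ((k : ℝ) / (2 ^ Λ : ℕ)) := by
    intro x hx hxi
    rw [hcast]
    exact hΛ.mem_grid hT₀ h hE hx.1 hxi
  have hcross := E.abs_cross_le i
  have finish : ∀ p q : Plane, dist (E.vert (i + 1)) (E.vert (i + 2)) ≤ 2 ^ Λ * dist p q →
      |E.cross| ≤ 2 ^ Λ * dist p q * Metric.diam E.carrier := fun p q hpq =>
    hcross.trans (by gcongr)
  rcases hk.lt_or_eq with hk | rfl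
  · rw [← hcast] at hp ⊢
    obtain ⟨q, hq, hedge, hd⟩ := exists_isEdge_of_grid hne (hn.edge_subset_frontier i)
      (h.vert_mem_nodesOn hT₀ hE _) (by positivity) hgrid hk hp
    rw [hcast] at hd hedge ⊢
    exact ⟨q, i, hi, hq, hedge, finish _ _ hd⟩
  -- At the last grid point there is no next one, so the edge is traversed backwards.
  · have hgrid' : ∀ x ∈ nodesOn T E, x ∈ segment ℝ (E.vert (i + 2)) (E.vert (i + 1)) →
      ∃ k : ℕ, k ≤ 2 ^ Λ ∧
        x = AffineMap.lineMap (E.vert (i + 2)) (E.vert (i + 1)) ((k : ℝ) / (2 ^ Λ : ℕ)) := by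
      intro x hx hxi
      rw [segment_symm] at hxi
      obtain ⟨k, hk, hkx⟩ := hgrid x hx hxi
      refine ⟨2 ^ Λ - k, by omega, ?_⟩
      rw [hkx, Nat.cast_sub hk, sub_div, div_self (by positivity), AffineMap.lineMap_apply_one_sub]
    have e : (AffineMap.lineMap (E.vert (i + 1)) (E.vert (i + 2)) (((2 ^ Λ : ℕ) : ℝ) / 2 ^ Λ) :
        Plane) =
          AffineMap.lineMap (E.vert (i + 2)) (E.vert (i + 1)) (((0 : ℕ) : ℝ) / (2 ^ Λ : ℕ)) := by
      simp
    rw [e] at hp hi ⊢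
    obtain ⟨q, hq, hedge, hd⟩ := exists_isEdge_of_grid hne.symm
      (by rw [segment_symm]; exact hn.edge_subset_frontier i)
      (h.vert_mem_nodesOn hT₀ hE _) (by positivity) hgrid' (by positivity) hp
    rw [segment_symm] at hq
    rw [dist_comm] at hd
    replace hd := hd.trans_eq (congrArg (· * _) hcast)
    exact ⟨q, i, hi, hq, hedge, finish _ _ hd⟩

/-- The number of elements that contain a point is bounded by the shape regularity. -/
theorem IsRefinement.card_filter_le (hT₀ : IsConformingPartition Ω T₀) (h : IsRefinement T₀ T)
    {σ : ℝ} (hσ : IsShapeRegular σ T₀) (hσ0 : 0 < σ) (x : Plane) (F : Finset MarkedTriangle)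
    (hFT : F ⊆ T) (hFx : ∀ E ∈ F, x ∈ E.carrier) :
    (F.card : ℝ) ≤ 4 * σ * volume.real (Metric.closedBall (0 : Plane) 1) := by
  obtain ⟨r, hr0, hr⟩ : ∃ r : ℝ, 0 < r ∧ ∀ E ∈ F, r ≤ Metric.diam E.carrier := by
    rcases F.eq_empty_or_nonempty with rfl | hne
    · exact ⟨1, one_pos, by simp⟩
    · obtain ⟨E, hE, hmin⟩ := F.exists_min_image (fun E => Metric.diam E.carrier) hne
      exact ⟨_, (h.nondegenerate hT₀ (hFT hE)).diam_pos, hmin⟩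
  -- Each element is shrunk towards `x` to the smallest diameter `r`. The copies stay inside their
  -- elements, hence do not overlap, lie in the ball of radius `r`, and have area at least `r ^ 2 /
  -- (4 * σ)`; comparing areas bounds their number.
  set A : MarkedTriangle → Set Plane := fun E =>
    AffineMap.homothety x (r / Metric.diam E.carrier) '' E.carrier
  have hpos : ∀ E ∈ F, 0 < Metric.diam E.carrier := fun E hE =>
    (h.nondegenerate hT₀ (hFT hE)).diam_pos
  have hA1 : ∀ E ∈ F, A E ⊆ E.carrier := by
    rintro E hE _ ⟨y, hy, rfl⟩
    rw [AffineMap.homothety_eq_lineMap]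
    exact E.convex_carrier.lineMap_mem (hFx E hE) hy
      ⟨(div_pos hr0 (hpos E hE)).le, (div_le_one (hpos E hE)).2 (hr E hE)⟩
  have hA2 : ∀ E ∈ F, A E ⊆ Metric.closedBall x r := by
    rintro E hE _ ⟨y, hy, rfl⟩
    rw [Metric.mem_closedBall, dist_homothety_center, Real.norm_eq_abs,
      abs_of_pos (div_pos hr0 (hpos E hE)), div_mul_eq_mul_div, div_le_iff₀ (hpos E hE)]
    gcongr
    exact E.dist_le_diam (hFx E hE) hy
  have hAvol : ∀ E ∈ F, r ^ 2 / (4 * σ) ≤ volume.real (A E) := by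
    intro E hE
    have hd := hpos E hE
    rw [Measure.real, Measure.addHaar_image_homothety, ENNReal.toReal_mul,
      ENNReal.toReal_ofReal (abs_nonneg _), finrank_euclideanSpace, Fintype.card_fin,
      abs_of_nonneg (by positivity), div_pow]
    change _ ≤ _ * E.area
    have := h.diam_sq_le hT₀ hσ (hFT hE)
    rw [div_mul_eq_mul_div, div_le_div_iff₀ (by positivity) (by positivity), mul_assoc]
    gcongr
    linarith
  have hcomp : ∀ E ∈ F, IsCompact (A E) := fun E _ =>
    E.isCompact_carrier.image (AffineMap.homothety_continuous _ _)
  have hsum : ∑ E ∈ F, volume.real (A E) ≤ volume.real (Metric.closedBall x r) := by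
    rw [← measureReal_biUnion_finset₀ (h := fun E hE => (hcomp E hE).measure_lt_top.ne)]
    · exact measureReal_mono (Set.iUnion₂_subset hA2)
        (measure_closedBall_lt_top.ne)
    · intro S hS E hE hne
      exact (aedisjoint_carrier (h.disjoint_interior hT₀ S (hFT hS) E (hFT hE) hne)).mono
        (hA1 S hS) (hA1 E hE)
    · exact fun E hE => (hcomp E hE).measurableSet.nullMeasurableSet
  have hball : volume.real (Metric.closedBall x r) =
      r ^ 2 * volume.real (Metric.closedBall (0 : Plane) 1) := by
    rw [Measure.addHaar_real_closedBall _ _ hr0.le, finrank_euclideanSpace, Fintype.card_fin,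
      Measure.addHaar_real_closedBall_eq_addHaar_real_ball]
  have h1 := (Finset.card_nsmul_le_sum F _ _ hAvol).trans hsum
  rw [hball, nsmul_eq_mul, mul_div_assoc', div_le_iff₀ (by positivity)] at h1
  have hr2 : 0 < r ^ 2 := by positivity
  refine le_of_mul_le_mul_right (h1.trans_eq (by ring)) hr2

end Mesh

/-! ### Trace and Poincaré inequality on a convex set. -/

section Analysis

open scoped ENNReal NNReal

theorem eLpNorm_two_sq {α F : Type*} [MeasurableSpace α] [NormedAddCommGroup F] (f : α → F)
    (μ : Measure α) : eLpNorm f 2 μ ^ 2 = ∫⁻ x, ‖f x‖ₑ ^ 2 ∂μ := by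
  have := eLpNorm_nnreal_pow_eq_lintegral (f := f) (μ := μ) (p := 2) (by norm_num)
  simpa using this

theorem sq_lintegral_enorm_le {α F : Type*} [MeasurableSpace α] [NormedAddCommGroup F] {f : α → F}
    {μ : Measure α} [IsProbabilityMeasure μ] (hf : AEStronglyMeasurable f μ) :
    (∫⁻ x, ‖f x‖ₑ ∂μ) ^ 2 ≤ ∫⁻ x, ‖f x‖ₑ ^ 2 ∂μ := by
  rw [← eLpNorm_two_sq, ← eLpNorm_one_eq_lintegral_enorm]
  gcongr
  exact eLpNorm_le_eLpNorm_of_exponent_le (by norm_num) hf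

instance : IsProbabilityMeasure (volume.restrict (Set.Ioc (0 : ℝ) 1)) := ⟨by simp⟩

theorem enorm_gradient (φ : Plane → ℝ) (x : Plane) : ‖gradient φ x‖ₑ = ‖fderiv ℝ φ x‖ₑ := by
  rw [gradient, LinearIsometryEquiv.enorm_map]

theorem continuous_gradient {φ : Plane → ℝ} (hφ : ContDiff ℝ 1 φ) : Continuous (gradient φ) :=
  (LinearIsometryEquiv.continuous _).comp (hφ.continuous_fderiv one_ne_zero)

/-- Integration along the path `r ↦ y + r² (z - y)`. -/
theorem enorm_sub_sq_le {φ : Plane → ℝ} (hφ : ContDiff ℝ 1 φ) (y z : Plane) {D : ℝ}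
    (hD : ‖z - y‖ ≤ D) : ‖φ z - φ y‖ₑ ^ 2 ≤
      ∫⁻ r in Set.Ioc (0 : ℝ) 1, ENNReal.ofReal (4 * r ^ 2 * D ^ 2) *
        ‖gradient φ (y + r ^ 2 • (z - y))‖ₑ ^ 2 := by
  have hpath : ∀ r : ℝ, HasDerivAt (fun r : ℝ => y + r ^ 2 • (z - y)) ((2 * r) • (z - y)) r := by
    intro r
    have := ((hasDerivAt_pow 2 r).smul_const (z - y)).const_add y
    simpa using this
  have hderiv : ∀ r : ℝ, HasDerivAt (fun r : ℝ => φ (y + r ^ 2 • (z - y)))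
      (fderiv ℝ φ (y + r ^ 2 • (z - y)) ((2 * r) • (z - y))) r := fun r =>
    ((hφ.differentiable one_ne_zero).differentiableAt.hasFDerivAt).comp_hasDerivAt r (hpath r)
  have hcont : Continuous fun r : ℝ => fderiv ℝ φ (y + r ^ 2 • (z - y)) ((2 * r) • (z - y)) := by
    have := hφ.continuous_fderiv one_ne_zero
    fun_prop
  have hftc := intervalIntegral.integral_eq_sub_of_hasDerivAt (a := 0) (b := 1)
    (fun r _ => hderiv r) (hcont.intervalIntegrable _ _)
  simp only [one_pow, one_smul, add_sub_cancel, ne_eq, OfNat.ofNat_ne_zero, not_false_eq_true,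
    zero_pow, zero_smul, add_zero] at hftc
  rw [← hftc, intervalIntegral.integral_of_le zero_le_one]
  calc _ ≤ (∫⁻ r in Set.Ioc (0 : ℝ) 1,
        ‖fderiv ℝ φ (y + r ^ 2 • (z - y)) ((2 * r) • (z - y))‖ₑ) ^ 2 := by
        gcongr; exact enorm_integral_le_lintegral_enorm _
    _ ≤ _ := sq_lintegral_enorm_le hcont.aestronglyMeasurable
    _ ≤ _ := by
      refine setLIntegral_mono' measurableSet_Ioc fun r hr => ?_
      rw [enorm_gradient]
      have h1 : ‖fderiv ℝ φ (y + r ^ 2 • (z - y)) ((2 * r) • (z - y))‖ₑ ≤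
          ‖fderiv ℝ φ (y + r ^ 2 • (z - y))‖ₑ * ENNReal.ofReal (2 * r * D) := by
        refine (ContinuousLinearMap.le_opENorm _ _).trans ?_
        gcongr
        rw [← ofReal_norm, norm_smul, Real.norm_eq_abs, abs_of_pos (by linarith [hr.1])]
        exact ENNReal.ofReal_le_ofReal (mul_le_mul_of_nonneg_left hD (by linarith [hr.1]))
      have hD0 : 0 ≤ D := (norm_nonneg _).trans hD
      calc _ ≤ (‖fderiv ℝ φ (y + r ^ 2 • (z - y))‖ₑ * ENNReal.ofReal (2 * r * D)) ^ 2 := by gcongr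
        _ = _ := by
          rw [mul_pow, ← ENNReal.ofReal_pow (by have := hr.1; positivity), mul_comm]
          congr 2
          ring

theorem lintegral_homothety (h : Plane → ℝ≥0∞) (hh : Measurable h) (y : Plane) {c : ℝ}
    (hc : 0 < c) :
    ∫⁻ z, h (y + c • (z - y)) = ENNReal.ofReal ((c ^ 2)⁻¹) * ∫⁻ z, h z := by
  rw [lintegral_sub_right_eq_self (fun z => h (y + c • z)) y,
    ← lintegral_map (f := fun z => h (y + z)) (g := fun z : Plane => c • z) (by fun_prop)
      (by fun_prop), Measure.map_addHaar_smul _ hc.ne', lintegral_smul_measure,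
    lintegral_add_left_eq_self h y, finrank_euclideanSpace, Fintype.card_fin,
    abs_of_pos (by positivity), smul_eq_mul]

/-- Averaging the base point over a segment gains this factor `ρ`, which compensates the singularity
of the contraction towards the base point. -/
theorem volume_parameter_le (u p a : Plane) (ha : a ≠ 0) (ρ : ℝ) :
    volume {t : ℝ | dist u (p + t • a) ≤ ρ} ≤ ENNReal.ofReal (2 * ρ / ‖a‖) := by
  refine (Real.volume_le_diam _).trans ?_
  apply Metric.ediam_le_of_forall_dist_le
  intro s hs t ht
  have hpos : 0 < ‖a‖ := norm_pos_iff.2 ha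
  have h1 : dist (p + s • a) (p + t • a) ≤ 2 * ρ := by
    have := dist_triangle_left (p + s • a) (p + t • a) u
    have h2 : dist u (p + s • a) ≤ ρ := hs
    have h3 : dist u (p + t • a) ≤ ρ := ht
    linarith
  rw [dist_add_left, dist_eq_norm, ← sub_smul, norm_smul] at h1
  rwa [le_div_iff₀ hpos, dist_eq_norm]

/-- The contraction by `c` towards `y` maps `K` into its part within distance `c * D` of `y`, with
Jacobian `c ^ 2`. The indicator is kept because integrating it over `y` later absorbs part of the
factor `c⁻²`. -/
theorem lintegral_contracted_le {g : Plane → ℝ≥0∞} (hg : Measurable g) {K : Set Plane}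
    (hKm : MeasurableSet K) (hK : Convex ℝ K) {D : ℝ} (hD : ∀ x ∈ K, ∀ y ∈ K, dist x y ≤ D)
    {y : Plane} (hy : y ∈ K) {c : ℝ} (hc : 0 < c) (hc1 : c ≤ 1) :
    ∫⁻ z in K, g (y + c • (z - y)) ≤
      ENNReal.ofReal ((c ^ 2)⁻¹) * ∫⁻ u in K, {u | dist u y ≤ c * D}.indicator g u := by
  have hset : MeasurableSet {u : Plane | dist u y ≤ c * D} :=
    (isClosed_le (by fun_prop) (by fun_prop)).measurableSet
  have hH : Measurable (K.indicator ({u | dist u y ≤ c * D}.indicator g)) :=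
    (hg.indicator hset).indicator hKm
  rw [← lintegral_indicator hKm ({u | dist u y ≤ c * D}.indicator g),
    ← lintegral_homothety _ hH y hc, ← lintegral_indicator hKm]
  refine lintegral_mono fun z => ?_
  by_cases hz : z ∈ K
  swap
  · simp [Set.indicator_of_notMem hz]
  rw [Set.indicator_of_mem hz]
  have h1 : y + c • (z - y) ∈ K := hK.add_smul_sub_mem hy hz ⟨hc.le, hc1⟩
  have h2 : y + c • (z - y) ∈ {u | dist u y ≤ c * D} := by
    change dist _ _ ≤ _
    rw [dist_eq_norm, add_sub_cancel_left, norm_smul, Real.norm_eq_abs,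
      abs_of_pos hc, ← dist_eq_norm]
    exact mul_le_mul_of_nonneg_left (hD z hz y hy) hc.le
  rw [Set.indicator_of_mem h1, Set.indicator_of_mem h2]

theorem lintegral_sub_point_le {φ : Plane → ℝ} (hφ : ContDiff ℝ 1 φ) {K : Set Plane}
    (hKm : MeasurableSet K) (hK : Convex ℝ K) {D : ℝ} (hD : ∀ x ∈ K, ∀ y ∈ K, dist x y ≤ D)
    {y : Plane} (hy : y ∈ K) :
    ∫⁻ z in K, ‖φ z - φ y‖ₑ ^ 2 ≤ ∫⁻ r in Set.Ioc (0 : ℝ) 1, ∫⁻ u in K,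
      ENNReal.ofReal (4 * r ^ 2 * D ^ 2 * ((r ^ 2) ^ 2)⁻¹) *
        {u | dist u y ≤ r ^ 2 * D}.indicator (fun u => ‖gradient φ u‖ₑ ^ 2) u := by
  have hg := continuous_gradient hφ
  have hg2 : Continuous fun u => ‖gradient φ u‖ₑ ^ 2 := by fun_prop
  calc _ ≤ ∫⁻ z in K, ∫⁻ r in Set.Ioc (0 : ℝ) 1, ENNReal.ofReal (4 * r ^ 2 * D ^ 2) *
        ‖gradient φ (y + r ^ 2 • (z - y))‖ₑ ^ 2 := by
        refine setLIntegral_mono' hKm fun z hz => ?_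
        exact enorm_sub_sq_le hφ y z (by rw [← dist_eq_norm]; exact hD z hz y hy)
    _ = ∫⁻ r in Set.Ioc (0 : ℝ) 1, ∫⁻ z in K, ENNReal.ofReal (4 * r ^ 2 * D ^ 2) *
        ‖gradient φ (y + r ^ 2 • (z - y))‖ₑ ^ 2 := by
        rw [lintegral_lintegral_swap]
        apply Measurable.aemeasurable
        simp only [Function.uncurry_def]
        have : Continuous fun x : Plane × ℝ =>
            ‖gradient φ (y + x.2 ^ 2 • (x.1 - y))‖ₑ ^ 2 := by fun_prop
        exact (ENNReal.measurable_ofReal.comp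
          (by fun_prop : Measurable fun x : Plane × ℝ => 4 * x.2 ^ 2 * D ^ 2)).mul this.measurable
    _ ≤ _ := by
        refine setLIntegral_mono' measurableSet_Ioc fun r hr => ?_
        have hr2 : 0 < r ^ 2 := by have := hr.1; positivity
        have hr1 : r ^ 2 ≤ 1 := pow_le_one₀ hr.1.le hr.2
        rw [lintegral_const_mul' _ _ ENNReal.ofReal_ne_top,
          lintegral_const_mul' _ _ ENNReal.ofReal_ne_top,
          ENNReal.ofReal_mul (p := 4 * r ^ 2 * D ^ 2) (by positivity)]
        exact (mul_le_mul' le_rfl (lintegral_contracted_le hg2.measurable hKm hK hD hy hr2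
          hr1)).trans_eq (mul_assoc _ _ _).symm

/-- A trace and Poincaré inequality on a convex set. -/
theorem lintegral_sub_segment_le {φ : Plane → ℝ} (hφ : ContDiff ℝ 1 φ) {K : Set Plane}
    (hKm : MeasurableSet K) (hK : Convex ℝ K) {D : ℝ} (hD : ∀ x ∈ K, ∀ y ∈ K, dist x y ≤ D)
    {p a : Plane} (ha : a ≠ 0) (hmem : ∀ t ∈ Set.Ioc (0 : ℝ) 1, p + t • a ∈ K) :
    ∫⁻ z in K, ∫⁻ t in Set.Ioc (0 : ℝ) 1, ‖φ z - φ (p + t • a)‖ₑ ^ 2 ≤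
      ENNReal.ofReal (8 * D ^ 3 / ‖a‖) * ∫⁻ z in K, ‖gradient φ z‖ₑ ^ 2 := by
  have hφc := hφ.continuous
  have hg := continuous_gradient hφ
  have hg2 : Continuous fun u => ‖gradient φ u‖ₑ ^ 2 := by fun_prop
  have hD0 : 0 ≤ D := dist_nonneg.trans
    (hD _ (hmem 1 (by simp)) _ (hmem 1 (by simp)))
  have hpos : 0 < ‖a‖ := norm_pos_iff.2 ha
  have hS : MeasurableSet {x : ℝ × ℝ × Plane | dist x.2.2 (p + x.1 • a) ≤ x.2.1 ^ 2 * D} :=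
    (isClosed_le (by fun_prop) (by fun_prop)).measurableSet
  set B : ℝ → ℝ → Plane → ℝ≥0∞ := fun t r u =>
    ENNReal.ofReal (4 * r ^ 2 * D ^ 2 * ((r ^ 2) ^ 2)⁻¹) *
      {u | dist u (p + t • a) ≤ r ^ 2 * D}.indicator (fun u => ‖gradient φ u‖ₑ ^ 2) u with hBdef
  have hB : Measurable fun x : ℝ × ℝ × Plane => B x.1 x.2.1 x.2.2 := by
    refine Measurable.mul (ENNReal.measurable_ofReal.comp (by fun_prop)) ?_
    have : Measurable fun x : ℝ × ℝ × Plane => ‖gradient φ x.2.2‖ₑ ^ 2 :=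
      (hg2.comp (by fun_prop : Continuous fun x : ℝ × ℝ × Plane => x.2.2)).measurable
    exact this.indicator hS
  -- All powers of `r` cancel: `r ^ 2` from the speed of the path, `r ^ (-4)` from the Jacobian and
  -- `r ^ 2` from the length of the set of parameters. The path is quadratic in `r` for this reason;
  -- a linear one would leave the non-integrable `1 / r`.
  have hfiber : ∀ r ∈ Set.Ioc (0 : ℝ) 1, ∀ u, ∫⁻ t in Set.Ioc (0 : ℝ) 1, B t r u ≤
      ENNReal.ofReal (8 * D ^ 3 / ‖a‖) * ‖gradient φ u‖ₑ ^ 2 := by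
    intro r hr u
    have hr0 := hr.1
    have e : ∀ t, B t r u = ENNReal.ofReal (4 * r ^ 2 * D ^ 2 * ((r ^ 2) ^ 2)⁻¹) *
        {t : ℝ | dist u (p + t • a) ≤ r ^ 2 * D}.indicator
          (fun _ => ‖gradient φ u‖ₑ ^ 2) t := fun t => rfl
    simp only [e]
    have hset : MeasurableSet {t : ℝ | dist u (p + t • a) ≤ r ^ 2 * D} :=
      (isClosed_le (by fun_prop) (by fun_prop)).measurableSet
    rw [lintegral_const_mul' _ _ ENNReal.ofReal_ne_top, lintegral_indicator_const hset]
    calc _ ≤ ENNReal.ofReal (4 * r ^ 2 * D ^ 2 * ((r ^ 2) ^ 2)⁻¹) *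
          (‖gradient φ u‖ₑ ^ 2 * ENNReal.ofReal (2 * (r ^ 2 * D) / ‖a‖)) := by
          gcongr
          exact (Measure.restrict_apply_le _ _).trans (volume_parameter_le u p a ha _)
      _ = _ := by
          rw [mul_comm (_ ^ 2), ← mul_assoc, ← ENNReal.ofReal_mul (by positivity)]
          congr 2
          field_simp
          ring
  clear_value B
  calc ∫⁻ z in K, ∫⁻ t in Set.Ioc (0 : ℝ) 1, ‖φ z - φ (p + t • a)‖ₑ ^ 2
      = ∫⁻ t in Set.Ioc (0 : ℝ) 1, ∫⁻ z in K, ‖φ z - φ (p + t • a)‖ₑ ^ 2 := by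
        rw [lintegral_lintegral_swap]
        have : Continuous (Function.uncurry fun (z : Plane) (t : ℝ) =>
            ‖φ z - φ (p + t • a)‖ₑ ^ 2) := by
          simp only [Function.uncurry_def]; fun_prop
        exact this.measurable.aemeasurable
    _ ≤ ∫⁻ t in Set.Ioc (0 : ℝ) 1, ∫⁻ r in Set.Ioc (0 : ℝ) 1, ∫⁻ u in K, B t r u := by
        refine setLIntegral_mono' measurableSet_Ioc fun t ht => ?_
        rw [hBdef]
        exact lintegral_sub_point_le hφ hKm hK hD (hmem t ht)
    _ = ∫⁻ r in Set.Ioc (0 : ℝ) 1, ∫⁻ t in Set.Ioc (0 : ℝ) 1, ∫⁻ u in K, B t r u := by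
        rw [lintegral_lintegral_swap]
        apply Measurable.aemeasurable
        simp only [Function.uncurry_def]
        have : Measurable fun x : (ℝ × ℝ) × Plane => B x.1.1 x.1.2 x.2 :=
          hB.comp (by fun_prop : Measurable fun x : (ℝ × ℝ) × Plane => (x.1.1, x.1.2, x.2))
        exact this.lintegral_prod_right'
    _ = ∫⁻ r in Set.Ioc (0 : ℝ) 1, ∫⁻ u in K, ∫⁻ t in Set.Ioc (0 : ℝ) 1, B t r u := by
        refine lintegral_congr fun r => ?_
        rw [lintegral_lintegral_swap]
        apply Measurable.aemeasurable
        simp only [Function.uncurry_def]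
        exact hB.comp (by fun_prop : Measurable fun x : ℝ × Plane => (x.1, r, x.2))
    _ ≤ ∫⁻ r in Set.Ioc (0 : ℝ) 1, ∫⁻ u in K,
          ENNReal.ofReal (8 * D ^ 3 / ‖a‖) * ‖gradient φ u‖ₑ ^ 2 :=
        setLIntegral_mono' measurableSet_Ioc fun r hr => lintegral_mono fun u => hfiber r hr u
    _ = _ := by
        rw [lintegral_const, lintegral_const_mul' _ _ ENNReal.ofReal_ne_top]
        simp

/-- Fatou's lemma, applied to the inner and then to the outer integral. -/
theorem lintegral_lintegral_le_of_tendsto {α β : Type*} [MeasurableSpace α] [MeasurableSpace β]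
    {μ : Measure α} {ν : Measure β} [SFinite ν] {f : ℕ → α → β → ℝ≥0∞}
    (hf : ∀ k, Measurable (Function.uncurry (f k))) {g : α → β → ℝ≥0∞}
    (hfg : ∀ᵐ x ∂μ, ∀ᵐ y ∂ν, Tendsto (fun k => f k x y) atTop (𝓝 (g x y))) {b : ℕ → ℝ≥0∞}
    (hb : ∀ k, ∫⁻ x, ∫⁻ y, f k x y ∂ν ∂μ ≤ b k) {c : ℝ≥0∞} (hc : Tendsto b atTop (𝓝 c)) :
    ∫⁻ x, ∫⁻ y, g x y ∂ν ∂μ ≤ c := by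
  calc ∫⁻ x, ∫⁻ y, g x y ∂ν ∂μ ≤ ∫⁻ x, liminf (fun k => ∫⁻ y, f k x y ∂ν) atTop ∂μ := by
        refine lintegral_mono_ae ?_
        filter_upwards [hfg] with x hx
        calc ∫⁻ y, g x y ∂ν = ∫⁻ y, liminf (fun k => f k x y) atTop ∂ν := by
              refine lintegral_congr_ae ?_
              filter_upwards [hx] with y hy
              exact hy.liminf_eq.symm
          _ ≤ _ := lintegral_liminf_le fun k => (hf k).comp measurable_prodMk_left
    _ ≤ liminf (fun k => ∫⁻ x, ∫⁻ y, f k x y ∂ν ∂μ) atTop :=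
        lintegral_liminf_le fun k => (hf k).lintegral_prod_right'
    _ ≤ liminf b atTop := liminf_le_liminf (Eventually.of_forall hb)
    _ = c := hc.liminf_eq

/-- A null set meets almost every translate of a segment in a null set. -/
theorem ae_ae_segment {P : Plane → Prop} (hP : ∀ᵐ x, P x) (p a d : Plane)
    (had : planeCross a d ≠ 0) : ∀ᵐ ε : ℝ, ∀ᵐ t : ℝ, P (p + t • a + ε • d) := by
  -- Since `a` and `d` are independent, they give linear coordinates on the plane that preserve null
  -- sets; Fubini then applies.
  have h1 : ∀ᵐ x : Plane, P (p + planeMap a d x) := by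
    have h2 : ∀ᵐ x : Plane, P (p + x) :=
      (measurePreserving_add_left volume p).quasiMeasurePreserving.ae hP
    rw [ae_iff] at h2 ⊢
    have := Measure.addHaar_preimage_linearMap volume (f := planeMap a d)
      (by rwa [planeMap_det]) {x | ¬ P (p + x)}
    rw [h2, mul_zero] at this
    exact this
  have h3 : ∀ᵐ x : Fin 2 → ℝ, P (p + planeMap a d (WithLp.toLp 2 x)) :=
    (PiLp.volume_preserving_toLp (Fin 2)).quasiMeasurePreserving.ae h1
  have h4 : ∀ᵐ x : ℝ × ℝ, P (p + planeMap a d (WithLp.toLp 2 ![x.1, x.2])) :=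
    ((volume_preserving_finTwoArrow ℝ).symm).quasiMeasurePreserving.ae h3
  have h5 : ∀ᵐ x : ℝ × ℝ, P (p + planeMap a d (WithLp.toLp 2 ![x.2, x.1])) :=
    (Measure.measurePreserving_swap (μ := (volume : Measure ℝ))
      (ν := (volume : Measure ℝ))).quasiMeasurePreserving.ae h4
  have h6 := Measure.ae_ae_of_ae_prod h5
  filter_upwards [h6] with ε hε
  filter_upwards [hε] with t ht
  simpa [planeMap_apply, add_assoc] using ht

/-- The trace and Poincaré inequality passes to limits of smooth functions. -/
theorem lintegral_sub_segment_le_of_tendsto {K : Set Plane} (hKm : MeasurableSet K)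
    (hK : Convex ℝ K) {D : ℝ} (hD : ∀ x ∈ K, ∀ y ∈ K, dist x y ≤ D) {w : Plane → ℝ}
    (hw : Continuous w) {φ : ℕ → Plane → ℝ} (hφ : ∀ k, ContDiff ℝ 1 (φ k))
    (hae : ∀ᵐ z ∂volume.restrict K, Tendsto (fun k => φ k z) atTop (𝓝 (w z))) {A : ℝ≥0∞}
    {b : ℕ → ℝ≥0∞} (hb : ∀ k, ∫⁻ z in K, ‖gradient (φ k) z‖ₑ ^ 2 ≤ b k)
    (hA : Tendsto b atTop (𝓝 A)) {p a d : Plane}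
    (had : planeCross a d ≠ 0)
    (hmem : ∀ t ∈ Set.Ioc (0 : ℝ) 1, ∀ ε ∈ Set.Ioc (0 : ℝ) 1, p + t • a + ε • d ∈ K) :
    ∫⁻ z in K, ∫⁻ t in Set.Ioc (0 : ℝ) 1, ‖w z - w (p + t • a)‖ₑ ^ 2 ≤
      ENNReal.ofReal (8 * D ^ 3 / ‖a‖) * A := by
  have ha : a ≠ 0 := by rintro rfl; simp [planeCross] at had
  -- Almost everywhere convergence says nothing on a single segment, which is a null set. On almost
  -- every translate by `ε • d` it does hold for almost every `t`, and the limit in `k` is taken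
  -- there.
  have hlim : ∀ᵐ ε ∂volume.restrict (Set.Ioc (0 : ℝ) 1),
      ∫⁻ z in K, ∫⁻ t in Set.Ioc (0 : ℝ) 1, ‖w z - w (p + ε • d + t • a)‖ₑ ^ 2 ≤
        ENNReal.ofReal (8 * D ^ 3 / ‖a‖) * A := by
    have hae' := (ae_restrict_iff' hKm).1 hae
    have hs := ae_ae_segment hae' p a d had
    filter_upwards [ae_restrict_mem measurableSet_Ioc, ae_restrict_of_ae hs] with ε hε hs
    have hmem' : ∀ t ∈ Set.Ioc (0 : ℝ) 1, p + ε • d + t • a ∈ K := by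
      intro t ht
      rw [add_right_comm]
      exact hmem t ht ε hε
    refine lintegral_lintegral_le_of_tendsto
      (f := fun k z t => ‖φ k z - φ k (p + ε • d + t • a)‖ₑ ^ 2) ?_ ?_
      (fun k => (lintegral_sub_segment_le (hφ k) hKm hK hD ha hmem').trans
        (mul_le_mul' le_rfl (hb k)))
      (ENNReal.Tendsto.const_mul hA (Or.inr ENNReal.ofReal_ne_top))
    · intro k
      have := (hφ k).continuous
      have : Continuous (Function.uncurry fun (z : Plane) (t : ℝ) =>
            ‖φ k z - φ k (p + ε • d + t • a)‖ₑ ^ 2) := by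
          simp only [Function.uncurry_def]; fun_prop
      exact this.measurable
    · filter_upwards [hae] with z hz
      filter_upwards [ae_restrict_mem measurableSet_Ioc, ae_restrict_of_ae hs] with t ht hs
      rw [add_right_comm] at hs
      have := hz.sub (hs (hmem' t ht))
      exact (((ENNReal.continuous_pow 2).comp continuous_enorm).tendsto _).comp this
  have hfreq : ∀ n : ℕ, ∃ ε : ℝ, (0 < ε ∧ ε ≤ 1 / ((n : ℝ) + 1)) ∧
      ∫⁻ z in K, ∫⁻ t in Set.Ioc (0 : ℝ) 1, ‖w z - w (p + ε • d + t • a)‖ₑ ^ 2 ≤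
        ENNReal.ofReal (8 * D ^ 3 / ‖a‖) * A := by
    intro n
    have hn : (0 : ℝ) < 1 / ((n : ℝ) + 1) := by positivity
    have hn1 : 1 / ((n : ℝ) + 1) ≤ 1 := by
      rw [div_le_one (by positivity)]
      linarith [(Nat.cast_nonneg n : (0 : ℝ) ≤ n)]
    have h1 := ae_restrict_of_ae_restrict_of_subset (Set.Ioc_subset_Ioc_right hn1) hlim
    have : (ae (volume.restrict (Set.Ioc (0 : ℝ) (1 / ((n : ℝ) + 1))))).NeBot := by
      rw [ae_neBot, Ne, Measure.restrict_eq_zero]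
      simp only [Real.volume_Ioc, sub_zero, ENNReal.ofReal_eq_zero, not_le]
      exact hn
    obtain ⟨ε, h1, h2⟩ := (h1.and (ae_restrict_mem measurableSet_Ioc)).exists
    exact ⟨ε, h2, h1⟩
  choose ε hε hεle using hfreq
  have hε0 : Tendsto ε atTop (𝓝 0) :=
    squeeze_zero (fun n => (hε n).1.le) (fun n => (hε n).2) tendsto_one_div_add_atTop_nhds_zero_nat
  -- The translates return to the original segment, where continuity of `w` and a second use of
  -- Fatou's lemma conclude.
  refine lintegral_lintegral_le_of_tendsto
    (f := fun k z t => ‖w z - w (p + ε k • d + t • a)‖ₑ ^ 2) ?_ ?_ hεle tendsto_const_nhds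
  · intro k
    have : Continuous (Function.uncurry fun (z : Plane) (t : ℝ) =>
          ‖w z - w (p + ε k • d + t • a)‖ₑ ^ 2) := by
        simp only [Function.uncurry_def]; fun_prop
    exact this.measurable
  · refine Eventually.of_forall fun z => Eventually.of_forall fun t => ?_
    have hc : Continuous fun e : ℝ => ‖w z - w (p + e • d + t • a)‖ₑ ^ 2 := by fun_prop
    have := (hc.tendsto 0).comp hε0
    simpa [Function.comp_def] using this

/-- The integral equals $X^2-X\beta+\beta^2/3$, whose minimum over $\beta$ is $X^2/4$, attained at
$\beta=3X/2$. -/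
theorem sq_le_lintegral_affine (X β : ℝ) :
    ‖X‖ₑ ^ 2 ≤ 4 * ∫⁻ t in Set.Ioc (0 : ℝ) 1, ‖X - t * β‖ₑ ^ 2 := by
  have e : ∀ x : ℝ, ‖x‖ₑ ^ 2 = ENNReal.ofReal (x ^ 2) := by
    intro x
    rw [← ofReal_norm, ← ENNReal.ofReal_pow (norm_nonneg _), Real.norm_eq_abs, sq_abs]
  have hc : Continuous fun t : ℝ => (X - t * β) ^ 2 := by fun_prop
  simp only [e]
  rw [← ofReal_integral_eq_lintegral_ofReal
    (hc.integrableOn_Icc.mono_set Set.Ioc_subset_Icc_self)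
    (Eventually.of_forall fun t => sq_nonneg _), ← intervalIntegral.integral_of_le zero_le_one]
  have hval : ∫ t in (0 : ℝ)..1, (X - t * β) ^ 2 = X ^ 2 - X * β + β ^ 2 / 3 := by
    have hd : ∀ t ∈ Set.uIcc (0 : ℝ) 1, HasDerivAt
        (fun t : ℝ => X ^ 2 * t - X * β * t ^ 2 + β ^ 2 / 3 * t ^ 3) ((X - t * β) ^ 2) t := by
      intro t _
      have h1 := (hasDerivAt_id t).const_mul (X ^ 2)
      have h2 := (hasDerivAt_pow 2 t).const_mul (X * β)
      have h3 := (hasDerivAt_pow 3 t).const_mul (β ^ 2 / 3)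
      refine ((h1.sub h2).add h3).congr_deriv ?_
      push_cast
      ring
    rw [intervalIntegral.integral_eq_sub_of_hasDerivAt hd (hc.intervalIntegrable _ _)]
    ring
  rw [hval, show (4 : ℝ≥0∞) = ENNReal.ofReal 4 by simp, ← ENNReal.ofReal_mul (by norm_num)]
  apply ENNReal.ofReal_le_ofReal
  nlinarith [sq_nonneg (3 * X - 2 * β)]

/-- A Poincaré inequality around the value at the endpoint of a segment on which the function is
affine. -/
theorem lintegral_sub_endpoint_le {K : Set Plane} (hKm : MeasurableSet K)
    (hK : Convex ℝ K) {D : ℝ} (hD : ∀ x ∈ K, ∀ y ∈ K, dist x y ≤ D) {w : Plane → ℝ}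
    (hw : Continuous w) {φ : ℕ → Plane → ℝ} (hφ : ∀ k, ContDiff ℝ 1 (φ k))
    (hae : ∀ᵐ z ∂volume.restrict K, Tendsto (fun k => φ k z) atTop (𝓝 (w z))) {A : ℝ≥0∞}
    {b : ℕ → ℝ≥0∞} (hb : ∀ k, ∫⁻ z in K, ‖gradient (φ k) z‖ₑ ^ 2 ≤ b k)
    (hA : Tendsto b atTop (𝓝 A)) {p a d : Plane}
    (had : planeCross a d ≠ 0)
    (hmem : ∀ t ∈ Set.Ioc (0 : ℝ) 1, ∀ ε ∈ Set.Ioc (0 : ℝ) 1, p + t • a + ε • d ∈ K) {β : ℝ}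
    (haff : ∀ t ∈ Set.Ioc (0 : ℝ) 1, w (p + t • a) = w p + t * β) :
    ∫⁻ z in K, ‖w z - w p‖ₑ ^ 2 ≤ 4 * (ENNReal.ofReal (8 * D ^ 3 / ‖a‖) * A) := by
  calc _ ≤ ∫⁻ z in K, 4 * ∫⁻ t in Set.Ioc (0 : ℝ) 1, ‖w z - w (p + t • a)‖ₑ ^ 2 := by
        refine lintegral_mono fun z => ?_
        refine (sq_le_lintegral_affine (w z - w p) β).trans_eq ?_
        congr 1
        refine setLIntegral_congr_fun measurableSet_Ioc fun t ht => ?_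
        simp only [haff t ht, sub_sub]
    _ = 4 * ∫⁻ z in K, ∫⁻ t in Set.Ioc (0 : ℝ) 1, ‖w z - w (p + t • a)‖ₑ ^ 2 :=
        lintegral_const_mul' _ _ (by simp)
    _ ≤ _ := by
        gcongr
        exact lintegral_sub_segment_le_of_tendsto hKm hK hD hw hφ hae hb hA had hmem

end Analysis

/-! ### Estimates on one element. -/

section Element

open scoped ENNReal NNReal
open MarkedTriangle

theorem volume_segment (a b : Plane) : volume (segment ℝ a b) = 0 := by
  have hsub : segment ℝ a b ⊆ (fun x => a + x) '' (planeMap (b - a) 0 '' Set.univ) := by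
    rw [segment_eq_image']
    rintro _ ⟨t, -, rfl⟩
    exact ⟨t • (b - a), ⟨EuclideanSpace.single 0 t, trivial, by simp [planeMap_apply]⟩, rfl⟩
  refine measure_mono_null hsub ?_
  rw [Set.image_add_left, measure_preimage_add, Measure.addHaar_image_linearMap, planeMap_det]
  simp [planeCross]

theorem IsPolygonalDomain.volume_frontier {Ω : Set Plane} (hΩ : IsPolygonalDomain Ω) :
    volume (frontier Ω) = 0 := by
  obtain ⟨S, hS⟩ := hΩ.boundary
  rw [hS]
  exact (measure_biUnion_null_iff (I := (S : Set (Plane × Plane))) S.countable_toSet).2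
    fun s _ => volume_segment _ _

/-- Elements are contained only in the closure of the domain; the boundary is a null set, so
integrals over elements are still controlled by integrals over `Ω`. -/
theorem IsPolygonalDomain.ae_le {Ω K : Set Plane} (hΩ : IsPolygonalDomain Ω)
    (hK : K ⊆ closure Ω) : K ≤ᵐ[volume] Ω := by
  have h : ∀ᵐ x, x ∉ frontier Ω := measure_eq_zero_iff_ae_notMem.1 hΩ.volume_frontier
  filter_upwards [h] with x hx hxK
  rw [hΩ.isOpen.frontier_eq] at hx
  by_contra hxΩ
  exact hx ⟨hK hxK, hxΩ⟩

/-- A subsequence of the test functions converges almost everywhere. For the gradients only an upper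
bound is needed: by the triangle inequality, `b k` is the square of the norm of the error plus the
norm of `G`. -/
theorem MemH10.exists_approx {Ω K : Set Plane} {v : Plane → ℝ} {G : Plane → Plane}
    (h : MemH10 Ω v G) (hK : K ≤ᵐ[volume] Ω) : ∃ (φ : ℕ → Plane → ℝ) (b : ℕ → ℝ≥0∞),
      (∀ k, ContDiff ℝ 1 (φ k)) ∧
      (∀ᵐ z ∂volume.restrict K, Tendsto (fun k => φ k z) atTop (𝓝 (v z))) ∧
      (∀ k, ∫⁻ z in K, ‖gradient (φ k) z‖ₑ ^ 2 ≤ b k) ∧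
      Tendsto b atTop (𝓝 (∫⁻ z in K, ‖G z‖ₑ ^ 2)) := by
  obtain ⟨φ, hφ, hv, hG⟩ := h.approx
  have hμ : volume.restrict K ≤ volume.restrict Ω := Measure.restrict_mono_ae hK
  have hv' : Tendsto (fun k => eLpNorm (φ k - v) 2 (volume.restrict K)) atTop (𝓝 0) :=
    tendsto_of_tendsto_of_tendsto_of_le_of_le tendsto_const_nhds hv (fun _ => zero_le)
      fun k => eLpNorm_mono_measure _ hμ
  have hG' : Tendsto (fun k => eLpNorm (gradient (φ k) - G) 2 (volume.restrict K)) atTop (𝓝 0) :=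
    tendsto_of_tendsto_of_tendsto_of_le_of_le tendsto_const_nhds hG (fun _ => zero_le)
      fun k => eLpNorm_mono_measure _ hμ
  have hC1 : ∀ k, ContDiff ℝ 1 (φ k) := fun k => (hφ k).contDiff.of_le (by simp)
  have hvm := h.memLp.aestronglyMeasurable.mono_measure hμ
  have hGm := h.memLp_grad.aestronglyMeasurable.mono_measure hμ
  obtain ⟨ns, hns, hae⟩ := (tendstoInMeasure_of_tendsto_eLpNorm two_ne_zero
    (fun k => (hC1 k).continuous.aestronglyMeasurable) hvm hv').exists_seq_tendsto_ae
  refine ⟨fun k => φ (ns k), fun k => (eLpNorm (gradient (φ (ns k)) - G) 2 (volume.restrict K) +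
    eLpNorm G 2 (volume.restrict K)) ^ 2, fun k => hC1 _, hae, fun k => ?_, ?_⟩
  · rw [← eLpNorm_two_sq]
    beta_reduce
    gcongr
    have := eLpNorm_add_le (p := 2) (((continuous_gradient (hC1 (ns k))).aestronglyMeasurable
      (μ := volume.restrict K)).sub hGm) hGm (by norm_num)
    rwa [sub_add_cancel] at this
  · rw [← eLpNorm_two_sq]
    have h1 := (hG'.comp hns.tendsto_atTop).add_const (eLpNorm G 2 (volume.restrict K))
    rw [zero_add] at h1
    exact ((ENNReal.continuous_pow 2).tendsto _).comp h1

theorem MemVEMSpace.exists_affine {Ω : Set Plane} {T : Finset MarkedTriangle}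
    {V : (E : MarkedTriangle) → Submodule ℝ C(E.carrier, ℝ)} {v : Plane → ℝ} {G : Plane → Plane}
    (hv : MemVEMSpace Ω T V v G) {E : MarkedTriangle} (hE : E ∈ T)
    (hV : IsLocalVEMSpace T E (V E)) {p q : Plane} (hpq : IsEdge T E p q) :
    ∃ (L : Plane →ₗ[ℝ] ℝ) (c : ℝ), ∀ x ∈ segment ℝ p q, v x = L x + c := by
  obtain ⟨w, hw, hwv⟩ := hv.restrict_mem E hE
  have hmem : boundaryTrace E w ∈ boundarySpace T E := by
    rw [← hV.trace_eq]
    exact Submodule.mem_map_of_mem hw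
  obtain ⟨L, c, hL⟩ := hmem p q hpq
  refine ⟨L, c, fun x hx => ?_⟩
  have hxf := hpq.segment_subset hx
  rw [← hL ⟨x, hxf⟩ hx, ← hwv ⟨x, E.frontier_subset_carrier hxf⟩]
  rfl

theorem MemVEMSpace.continuousOn {Ω : Set Plane} {T : Finset MarkedTriangle}
    {V : (E : MarkedTriangle) → Submodule ℝ C(E.carrier, ℝ)} {v : Plane → ℝ} {G : Plane → Plane}
    (hv : MemVEMSpace Ω T V v G) {E : MarkedTriangle} (hE : E ∈ T) :
    ContinuousOn v E.carrier := by
  obtain ⟨w, -, hwv⟩ := hv.restrict_mem E hE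
  rw [continuousOn_iff_continuous_domRestrict]
  have : E.carrier.domRestrict v = w := by ext x; exact (hwv x).symm
  rw [this]
  exact w.continuous

/-- The direction from the edge to the opposite vertex is transversal to the edge, so segments can
be pushed into the element along it. -/
theorem MarkedTriangle.Nondegenerate.planeCross_ne_zero {E : MarkedTriangle} (h : E.Nondegenerate)
    {i : Fin 3} {p q : Plane} (hp : p ∈ E.edge i) (hq : q ∈ E.edge i) (hpq : p ≠ q) :
    planeCross (q - p) (E.vert i - p) ≠ 0 := by
  have hc := h.cross_ne_zero
  rw [E.cross_eq i] at hc
  rw [edge, segment_eq_image'] at hp hq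
  obtain ⟨s, -, rfl⟩ := hp
  obtain ⟨t, -, rfl⟩ := hq
  have hst : t - s ≠ 0 := by
    intro h0
    rw [sub_eq_zero] at h0
    exact hpq (by rw [h0])
  have := mul_ne_zero hst hc
  convert this using 1
  simp [planeCross]
  ring

/-- The constant of the Poincaré inequality on an element. -/
noncomputable def elementConstant (Λ : ℕ) (σ : ℝ) : ℝ :=
  1024 * 2 ^ Λ * reference.area * σ ^ 2

variable {Ω : Set Plane} {T₀ T : Finset MarkedTriangle}

theorem lintegral_sub_node_le {Λ : ℕ} {σ : ℝ} (hΩ : IsPolygonalDomain Ω)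
    (hT₀ : IsConformingPartition Ω T₀) (hσ : IsShapeRegular σ T₀)
    (h : IsRefinement T₀ T) (hΛ : IsAdmissible T₀ Λ T)
    {V : (E : MarkedTriangle) → Submodule ℝ C(E.carrier, ℝ)} {v : Plane → ℝ} {G : Plane → Plane}
    (hv : MemVEMSpace Ω T V v G) {E : MarkedTriangle} (hE : E ∈ T)
    (hV : IsLocalVEMSpace T E (V E)) {p : Plane} (hp : p ∈ nodesOn T E) :
    ∫⁻ x in E.carrier, ‖v x - v p‖ₑ ^ 2 ≤
      ENNReal.ofReal (elementConstant Λ σ * E.area) * ∫⁻ x in E.carrier, ‖G x‖ₑ ^ 2 := by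
  have hn := h.nondegenerate hT₀ hE
  have hKm := E.isClosed_carrier.measurableSet
  obtain ⟨q, i, hpi, hqi, hpq, hlen⟩ := hΛ.exists_isEdge hT₀ h hE hp
  obtain ⟨L, c, hL⟩ := hv.exists_affine hE hV hpq
  obtain ⟨φ, b, hφ, hae, hb, hlim⟩ := hv.memH10.exists_approx
    (hΩ.ae_le (hT₀.carrier_subset_of_tree (h.inBisectionTree E hE)))
  obtain ⟨w₀, -, hw₀⟩ := hv.restrict_mem E hE
  -- `v` is known to be continuous only on the closed element; Tietze's theorem extends its
  -- restriction to the plane.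
  obtain ⟨w, hw⟩ := ContinuousMap.exists_restrict_eq E.isClosed_carrier w₀
  have hwv : ∀ x ∈ E.carrier, w x = v x := fun x hx => by
    rw [← hw₀ ⟨x, hx⟩, ← hw]; rfl
  have hpE := E.edge_subset_carrier i hpi
  have hqE := E.edge_subset_carrier i hqi
  have hseg : ∀ t ∈ Set.Ioc (0 : ℝ) 1, p + t • ((1 / 2 : ℝ) • (q - p)) ∈ segment ℝ p q := by
    intro t ht
    refine ⟨1 - t / 2, t / 2, by linarith [ht.2], by linarith [ht.1], by ring, ?_⟩
    module
  have hcross : planeCross ((1 / 2 : ℝ) • (q - p)) ((1 / 2 : ℝ) • (E.vert i - p)) ≠ 0 := by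
    have := hn.planeCross_ne_zero hpi hqi hpq.ne
    intro h0
    apply this
    simp only [planeCross, PiLp.smul_apply, smul_eq_mul] at h0 ⊢
    linear_combination 4 * h0
  -- The factors `1 / 2` keep the translated segments inside `E`: the point is the midpoint of one
  -- on the edge and one on the segment from `p` to the opposite vertex.
  have hmem : ∀ t ∈ Set.Ioc (0 : ℝ) 1, ∀ ε ∈ Set.Ioc (0 : ℝ) 1,
      p + t • ((1 / 2 : ℝ) • (q - p)) + ε • ((1 / 2 : ℝ) • (E.vert i - p)) ∈ E.carrier := by
    intro t ht ε hε
    have h1 : (1 / 2 : ℝ) • (p + t • (q - p)) + (1 / 2 : ℝ) • (p + ε • (E.vert i - p)) ∈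
        E.carrier :=
      E.convex_carrier
        (E.convex_carrier.add_smul_sub_mem hpE hqE (Set.Ioc_subset_Icc_self ht))
        (E.convex_carrier.add_smul_sub_mem hpE (E.vert_mem_carrier i) (Set.Ioc_subset_Icc_self hε))
        (by norm_num) (by norm_num) (by norm_num)
    convert h1 using 1
    module
  have haff : ∀ t ∈ Set.Ioc (0 : ℝ) 1, w (p + t • ((1 / 2 : ℝ) • (q - p))) =
      w p + t * L ((1 / 2 : ℝ) • (q - p)) := by
    intro t ht
    have h1 := E.convex_carrier.segment_subset hpE hqE (hseg t ht)
    rw [hwv _ h1, hwv p hpE, hL _ (hseg t ht), hL p (left_mem_segment _ _ _), map_add, map_smul,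
      smul_eq_mul]
    ring
  have hae' : ∀ᵐ z ∂volume.restrict E.carrier, Tendsto (fun k => φ k z) atTop (𝓝 (w z)) := by
    filter_upwards [hae, ae_restrict_mem hKm] with z hz hzE
    rwa [hwv z hzE]
  have key := lintegral_sub_endpoint_le hKm E.convex_carrier
    (fun x hx y hy => E.dist_le_diam hx hy) w.continuous hφ hae' hb hlim hcross hmem haff
  have heq : ∫⁻ x in E.carrier, ‖v x - v p‖ₑ ^ 2 = ∫⁻ x in E.carrier, ‖w x - w p‖ₑ ^ 2 :=
    setLIntegral_congr_fun hKm fun x hx => by simp only [hwv x hx, hwv p hpE]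
  rw [heq]
  refine key.trans ?_
  rw [← mul_assoc, show (4 : ℝ≥0∞) = ENNReal.ofReal 4 by simp, ← ENNReal.ofReal_mul (by norm_num)]
  refine mul_le_mul' (ENNReal.ofReal_le_ofReal ?_) le_rfl
  set D := Metric.diam E.carrier
  have hD : 0 < D := hn.diam_pos
  have hdist : 0 < dist p q := dist_pos.2 hpq.ne
  have hDσ : D ^ 2 ≤ 4 * σ * E.area := h.diam_sq_le hT₀ hσ hE
  have harea := E.area_eq
  have hpos := hn.area_pos
  have hna : ‖(1 / 2 : ℝ) • (q - p)‖ = dist p q / 2 := by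
    rw [norm_smul, ← dist_eq_norm, dist_comm]; norm_num; ring
  have h2 : (0 : ℝ) < 2 ^ Λ := by positivity
  have hκ := reference_area_pos
  rw [hna, elementConstant, ← mul_div_assoc, div_le_iff₀ (by positivity)]
  have h3 : E.area ≤ reference.area * (2 ^ Λ * dist p q * D) := by
    rw [harea]; gcongr
  have hσa : 0 ≤ 4 * σ * E.area := (sq_nonneg D).trans hDσ
  have h4 : D ^ 2 * D ^ 2 ≤ (4 * σ * E.area) * (4 * σ * E.area) := by gcongr
  have h5 : D ^ 4 * E.area ≤
      (4 * σ * E.area) * (4 * σ * E.area) * (reference.area * (2 ^ Λ * dist p q * D)) := by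
    calc D ^ 4 * E.area = (D ^ 2 * D ^ 2) * E.area := by ring
      _ ≤ _ := mul_le_mul h4 h3 hpos.le (mul_nonneg hσa hσa)
  have h6 : D ^ 3 * (D * E.area) ≤
      (16 * σ ^ 2 * E.area * (reference.area * (2 ^ Λ * dist p q))) * (D * E.area) := by
    calc _ = D ^ 4 * E.area := by ring
      _ ≤ _ := h5
      _ = _ := by ring
  have h7 := le_of_mul_le_mul_right h6 (by positivity)
  -- The square of `D ^ 2 ≤ 4 * σ * E.area` gives the 16, the trace inequality gives `4 * 8`, and
  -- halving the edge doubles the product 512 to the 1024 of `elementConstant`.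
  calc 4 * (8 * D ^ 3) = 32 * D ^ 3 := by ring
    _ ≤ 32 * (16 * σ ^ 2 * E.area * (reference.area * (2 ^ Λ * dist p q))) := by gcongr
    _ = _ := by ring

theorem lintegral_enorm_sq_eq {α F : Type*} [MeasurableSpace α] [NormedAddCommGroup F] {f : α → F}
    {μ : Measure α} (hf : Integrable (fun x => ‖f x‖ ^ 2) μ) :
    ∫⁻ x, ‖f x‖ₑ ^ 2 ∂μ = ENNReal.ofReal (∫ x, ‖f x‖ ^ 2 ∂μ) := by
  rw [ofReal_integral_eq_lintegral_ofReal hf (Eventually.of_forall fun x => by positivity)]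
  refine lintegral_congr fun x => ?_
  rw [← ofReal_norm, ENNReal.ofReal_pow (norm_nonneg _)]

theorem elementConstant_nonneg (Λ : ℕ) (σ : ℝ) : 0 ≤ elementConstant Λ σ := by
  have := reference_area_pos
  unfold elementConstant
  positivity

theorem integrableOn_grad {G : Plane → Plane} {v : Plane → ℝ} (hv : MemH10 Ω v G) :
    IntegrableOn (fun x => ‖G x‖ ^ 2) Ω :=
  hv.memLp_grad.integrable_norm_pow two_ne_zero

theorem integrableOn_grad_element (hΩ : IsPolygonalDomain Ω)
    (hT₀ : IsConformingPartition Ω T₀) (h : IsRefinement T₀ T) {G : Plane → Plane} {v : Plane → ℝ}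
    (hv : MemH10 Ω v G) {E : MarkedTriangle} (hE : E ∈ T) :
    IntegrableOn (fun x => ‖G x‖ ^ 2) E.carrier :=
  Integrable.mono_measure (integrableOn_grad hv) (Measure.restrict_mono_ae
    (hΩ.ae_le (hT₀.carrier_subset_of_tree (h.inBisectionTree E hE))))

theorem integral_sub_node_le {Λ : ℕ} {σ : ℝ} (hΩ : IsPolygonalDomain Ω)
    (hT₀ : IsConformingPartition Ω T₀) (hσ : IsShapeRegular σ T₀)
    (h : IsRefinement T₀ T) (hΛ : IsAdmissible T₀ Λ T)
    {V : (E : MarkedTriangle) → Submodule ℝ C(E.carrier, ℝ)} {v : Plane → ℝ} {G : Plane → Plane}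
    (hv : MemVEMSpace Ω T V v G) {E : MarkedTriangle} (hE : E ∈ T)
    (hV : IsLocalVEMSpace T E (V E)) {p : Plane} (hp : p ∈ nodesOn T E) :
    ∫ x in E.carrier, (v x - v p) ^ 2 ≤
      elementConstant Λ σ * E.area * ∫ x in E.carrier, ‖G x‖ ^ 2 := by
  have key := lintegral_sub_node_le hΩ hT₀ hσ h hΛ hv hE hV hp
  have hint : IntegrableOn (fun x => ‖v x - v p‖ ^ 2) E.carrier :=
    (((hv.continuousOn hE).sub continuousOn_const).norm.pow 2).integrableOn_compact
      E.isCompact_carrier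
  have hpos := (h.nondegenerate hT₀ hE).area_pos
  have hC := elementConstant_nonneg Λ σ
  rw [lintegral_enorm_sq_eq hint,
    lintegral_enorm_sq_eq (integrableOn_grad_element hΩ hT₀ h hv.memH10 hE),
    ← ENNReal.ofReal_mul (by positivity), ENNReal.ofReal_le_ofReal_iff
      (mul_nonneg (by positivity) (integral_nonneg fun x => by positivity))] at key
  simpa using key

/-- The constant `(v p - v q) ^ 2` is at most twice the sum of the squared deviations from the two
values. Integrated over `E`, both sides carry the factor `E.area`, which cancels. -/
theorem sq_sub_node_le {Λ : ℕ} {σ : ℝ} (hΩ : IsPolygonalDomain Ω)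
    (hT₀ : IsConformingPartition Ω T₀) (hσ : IsShapeRegular σ T₀)
    (h : IsRefinement T₀ T) (hΛ : IsAdmissible T₀ Λ T)
    {V : (E : MarkedTriangle) → Submodule ℝ C(E.carrier, ℝ)} {v : Plane → ℝ} {G : Plane → Plane}
    (hv : MemVEMSpace Ω T V v G) {E : MarkedTriangle} (hE : E ∈ T)
    (hV : IsLocalVEMSpace T E (V E)) {p q : Plane} (hp : p ∈ nodesOn T E) (hq : q ∈ nodesOn T E) :
    (v p - v q) ^ 2 ≤ 4 * elementConstant Λ σ * ∫ x in E.carrier, ‖G x‖ ^ 2 := by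
  have h1 := integral_sub_node_le hΩ hT₀ hσ h hΛ hv hE hV hp
  have h2 := integral_sub_node_le hΩ hT₀ hσ h hΛ hv hE hV hq
  have hint : ∀ r, IntegrableOn (fun x => (v x - v r) ^ 2) E.carrier := fun r =>
    (((hv.continuousOn hE).sub continuousOn_const).pow 2).integrableOn_compact E.isCompact_carrier
  have hpos := (h.nondegenerate hT₀ hE).area_pos
  have hconst : ∫ _ in E.carrier, (v p - v q) ^ 2 = E.area * (v p - v q) ^ 2 := by
    rw [setIntegral_const, smul_eq_mul]; rfl
  have h3 : ∫ _ in E.carrier, (v p - v q) ^ 2 ≤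
      ∫ x in E.carrier, (2 * (v x - v p) ^ 2 + 2 * (v x - v q) ^ 2) := by
    refine setIntegral_mono ?_ (((hint p).const_mul 2).add ((hint q).const_mul 2)) fun x => ?_
    · exact integrableOn_const E.isCompact_carrier.measure_lt_top.ne
    · simp only
      nlinarith [sq_nonneg ((v x - v p) + (v x - v q))]
  rw [integral_add ((hint p).const_mul 2) ((hint q).const_mul 2), integral_const_mul,
    integral_const_mul, hconst] at h3
  refine le_of_mul_le_mul_left (h3.trans ?_) hpos
  linarith

theorem integral_sq_le {Λ : ℕ} {σ : ℝ} (hΩ : IsPolygonalDomain Ω)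
    (hT₀ : IsConformingPartition Ω T₀) (hσ : IsShapeRegular σ T₀)
    (h : IsRefinement T₀ T) (hΛ : IsAdmissible T₀ Λ T)
    {V : (E : MarkedTriangle) → Submodule ℝ C(E.carrier, ℝ)} {v : Plane → ℝ} {G : Plane → Plane}
    (hv : MemVEMSpace Ω T V v G) {E : MarkedTriangle} (hE : E ∈ T)
    (hV : IsLocalVEMSpace T E (V E)) {p : Plane} (hp : p ∈ nodesOn T E) :
    (E.size ^ 2)⁻¹ * ∫ x in E.carrier, v x ^ 2 ≤
      2 * elementConstant Λ σ * (∫ x in E.carrier, ‖G x‖ ^ 2) + 2 * v p ^ 2 := by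
  have h1 := integral_sub_node_le hΩ hT₀ hσ h hΛ hv hE hV hp
  have hint : IntegrableOn (fun x => (v x - v p) ^ 2) E.carrier :=
    (((hv.continuousOn hE).sub continuousOn_const).pow 2).integrableOn_compact E.isCompact_carrier
  have hint' : IntegrableOn (fun x => v x ^ 2) E.carrier :=
    ((hv.continuousOn hE).pow 2).integrableOn_compact E.isCompact_carrier
  have hpos := (h.nondegenerate hT₀ hE).area_pos
  have hc : IntegrableOn (fun _ : Plane => 2 * v p ^ 2) E.carrier :=
    integrableOn_const E.isCompact_carrier.measure_lt_top.ne
  have hconst : ∫ _ in E.carrier, 2 * v p ^ 2 = E.area * (2 * v p ^ 2) := by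
    rw [setIntegral_const, smul_eq_mul]; rfl
  have h3 : ∫ x in E.carrier, v x ^ 2 ≤ ∫ x in E.carrier, (2 * (v x - v p) ^ 2 + 2 * v p ^ 2) := by
    refine setIntegral_mono hint' ((hint.const_mul 2).add hc) fun x => ?_
    simp only
    nlinarith [sq_nonneg ((v x - v p) - v p)]
  rw [integral_add (hint.const_mul 2) hc, integral_const_mul, hconst] at h3
  rw [size, Real.sq_sqrt hpos.le, inv_mul_le_iff₀ hpos]
  linarith

theorem sum_integral_grad_le (hΩ : IsPolygonalDomain Ω)
    (hT₀ : IsConformingPartition Ω T₀) (h : IsRefinement T₀ T) {G : Plane → Plane} {v : Plane → ℝ}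
    (hv : MemH10 Ω v G) :
    ∑ E ∈ T, ∫ x in E.carrier, ‖G x‖ ^ 2 ≤ ∫ x in Ω, ‖G x‖ ^ 2 := by
  -- Closed elements overlap along their boundaries; the interiors are truly disjoint and differ
  -- from them by null sets.
  have h1 : ∀ E ∈ T, ∫ x in E.carrier, ‖G x‖ ^ 2 = ∫ x in interior E.carrier, ‖G x‖ ^ 2 :=
    fun E _ => setIntegral_congr_set
      (interior_ae_eq_of_null_frontier E.volume_frontier).symm
  rw [Finset.sum_congr rfl h1, ← integral_biUnion_finset _
    (fun E _ => isOpen_interior.measurableSet) (h.disjoint_interior hT₀)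
    (fun E hE => (integrableOn_grad_element hΩ hT₀ h hv hE).mono_set interior_subset)]
  refine setIntegral_mono_set (integrableOn_grad hv) (Eventually.of_forall fun x => by positivity)
    (hΩ.ae_le (Set.iUnion₂_subset fun E hE => interior_subset.trans
      (hT₀.carrier_subset_of_tree (h.inBisectionTree E hE))))

end Element

/-! ### Sums of nodal values, by induction on the global index. -/

section NodalSums

variable {Ω : Set Plane} {T₀ T : Finset MarkedTriangle}

theorem HasGlobalIndex.mem_nodes {x : Plane} {n : ℕ} (h : HasGlobalIndex T₀ T x n) :
    x ∈ nodes T := by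
  cases h with
  | proper _ hx => exact hx.1
  | hanging _ _ _ _ hx => exact hx.1

/-- The nodes of global index at most `n`. -/
noncomputable def lowNodes (T₀ T : Finset MarkedTriangle) (n : ℕ) : Finset Plane :=
  ((finite_nodes T).subset
    (fun _ ⟨_, _, h⟩ => h.mem_nodes : {x | ∃ j ≤ n, HasGlobalIndex T₀ T x j} ⊆ nodes T)).toFinset

theorem mem_lowNodes {n : ℕ} {x : Plane} :
    x ∈ lowNodes T₀ T n ↔ ∃ j ≤ n, HasGlobalIndex T₀ T x j := by
  simp [lowNodes]

/-- The constant in the bound of the nodal values of index at most `n`. -/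
noncomputable def nodalConstant (a b : ℝ) : ℕ → ℝ
  | 0 => 0
  | n + 1 => a + b * nodalConstant a b n

theorem nodalConstant_nonneg {a b : ℝ} (ha : 0 ≤ a) (hb : 0 ≤ b) (n : ℕ) :
    0 ≤ nodalConstant a b n := by
  induction n with
  | zero => exact le_rfl
  | succ n ih => unfold nodalConstant; positivity

-- Double counting: after exchanging the sums, each node is counted once for every element with the
-- node on its boundary, and boundedly many elements contain a point.
open Classical in
theorem IsRefinement.sum_element_node_le (hT₀ : IsConformingPartition Ω T₀)
    (h : IsRefinement T₀ T) {σ : ℝ} (hσ : IsShapeRegular σ T₀) (hσ0 : 0 < σ) (X : Finset Plane)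
    {f : Plane → ℝ} (hf : ∀ x, 0 ≤ f x) :
    ∑ E ∈ T, ∑ x ∈ X with x ∈ nodesOn T E, f x ≤
      4 * σ * volume.real (Metric.closedBall (0 : Plane) 1) * ∑ x ∈ X, f x := by
  simp only [Finset.sum_filter]
  rw [Finset.sum_comm, Finset.mul_sum]
  refine Finset.sum_le_sum fun x _ => ?_
  rw [← Finset.sum_filter, Finset.sum_const, nsmul_eq_mul]
  refine mul_le_mul_of_nonneg_right ?_ (hf x)
  exact h.card_filter_le hT₀ hσ hσ0 x _ (Finset.filter_subset _ _) fun E hE =>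
    E.frontier_subset_carrier (Finset.mem_filter.1 hE).2.2

-- The dual count: each element is counted once for every node on its boundary.
open Classical in
theorem IsAdmissible.sum_node_element_le {Λ : ℕ} (hT₀ : IsConformingPartition Ω T₀)
    (h : IsRefinement T₀ T) (hΛ : IsAdmissible T₀ Λ T) (X : Finset Plane)
    {a : MarkedTriangle → ℝ} (ha : ∀ E, 0 ≤ a E) :
    ∑ x ∈ X, ∑ E ∈ T with x ∈ nodesOn T E, a E ≤ 3 * (2 ^ Λ + 1) * ∑ E ∈ T, a E := by
  simp only [Finset.sum_filter]
  rw [Finset.sum_comm, Finset.mul_sum]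
  refine Finset.sum_le_sum fun E hE => ?_
  rw [← Finset.sum_filter, Finset.sum_const, nsmul_eq_mul]
  refine mul_le_mul_of_nonneg_right ?_ (ha E)
  have h1 := hΛ.ncard_nodesOn_le hT₀ h hE
  have h2 : (X.filter fun x => x ∈ nodesOn T E).card ≤ (nodesOn T E).ncard := by
    rw [← Set.ncard_coe_finset]
    exact Set.ncard_le_ncard (fun x hx => (Finset.mem_filter.1 hx).2)
      ((finite_nodes T).subset Set.inter_subset_left)
  exact_mod_cast h2.trans h1

open Classical in
/-- The nodal values of index at most `n` are controlled by the gradient. -/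
theorem sum_sq_lowNodes_le {Λ : ℕ} {σ : ℝ} (hσ0 : 0 < σ) (hΩ : IsPolygonalDomain Ω)
    (hT₀ : IsConformingPartition Ω T₀) (hσ : IsShapeRegular σ T₀)
    (h : IsRefinement T₀ T) (hΛ : IsAdmissible T₀ Λ T)
    {V : (E : MarkedTriangle) → Submodule ℝ C(E.carrier, ℝ)}
    (hV : ∀ E ∈ T, IsLocalVEMSpace T E (V E)) {v : Plane → ℝ} {G : Plane → Plane}
    (hv : MemVEMSpace Ω T V v G) (hv0 : ∀ x ∈ properNodes T, v x = 0) (n : ℕ) :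
    ∑ x ∈ lowNodes T₀ T n, v x ^ 2 ≤
      nodalConstant (3 * (2 ^ Λ + 1) * (8 * elementConstant Λ σ))
        (3 * (2 ^ Λ + 1) * (2 * (4 * σ * volume.real (Metric.closedBall (0 : Plane) 1)))) n *
      ∑ E ∈ T, ∫ x in E.carrier, ‖G x‖ ^ 2 := by
  set I : MarkedTriangle → ℝ := fun E => ∫ x in E.carrier, ‖G x‖ ^ 2 with hI
  have hI0 : ∀ E, 0 ≤ I E := fun E => integral_nonneg fun x => by positivity
  have hC := elementConstant_nonneg Λ σ
  induction n with
  | zero =>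
    rw [nodalConstant, zero_mul]
    refine (Finset.sum_eq_zero fun x hx => ?_).le
    obtain ⟨j, hj, hx⟩ := mem_lowNodes.1 hx
    obtain rfl : j = 0 := by omega
    -- Index zero leaves only proper nodes, where `v` vanishes; a hanging node has index at least
    -- one.
    cases hx with
    | proper _ hx => rw [hv0 x hx]; norm_num
  | succ n ih =>
    set X := lowNodes T₀ T n
    -- The contribution of one element to a hanging node: $v(x)^2\le 2(v(x)-v(x'))^2+2v(x')^2$,
    -- where `sq_sub_node_le` turns the first 2 into 8 and the value at the parent is absorbed in
    -- the sum over all lower nodes of the element.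
    set a : MarkedTriangle → ℝ := fun E => 8 * elementConstant Λ σ * I E +
      2 * ∑ y ∈ X with y ∈ nodesOn T E, v y ^ 2 with hadef
    have ha : ∀ E, 0 ≤ a E := fun E => add_nonneg (mul_nonneg (by positivity) (hI0 E))
      (mul_nonneg zero_le_two (Finset.sum_nonneg fun y _ => sq_nonneg _))
    have hpt : ∀ x ∈ lowNodes T₀ T (n + 1), v x ^ 2 ≤ ∑ E ∈ T with x ∈ nodesOn T E, a E := by
      intro x hx
      obtain ⟨j, hj, hx⟩ := mem_lowNodes.1 hx
      cases hx with
      | proper _ hx =>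
        rw [hv0 x hx]
        simpa using Finset.sum_nonneg fun E _ => ha E
      | hanging _ S m k hx hS hmid hl hr =>
        -- This element has the hanging node inside an edge, hence its parents on the same edge. One
        -- parent suffices, and its index is at most `n`.
        obtain ⟨E, hE, i, hxi⟩ := h.exists_openSegment_of_hanging hT₀ hx
        subst hmid
        have hle := (hT₀.halved_edge_subset hS (h.inBisectionTree E hE) i hxi).1
        have hfr := (h.nondegenerate hT₀ hE).edge_subset_frontier i
        have hxE : S.mid ∈ nodesOn T E :=
          ⟨hx.1, hfr (openSegment_subset_segment _ _ _ hxi)⟩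
        have hlE : S.left ∈ nodesOn T E := ⟨hl.mem_nodes, hfr hle⟩
        have hlX : S.left ∈ X.filter fun y => y ∈ nodesOn T E :=
          Finset.mem_filter.2 ⟨mem_lowNodes.2 ⟨m, by omega, hl⟩, hlE⟩
        have h1 := sq_sub_node_le hΩ hT₀ hσ h hΛ hv hE (hV E hE) hxE hlE
        have h2 := Finset.single_le_sum (f := fun y => v y ^ 2) (fun y _ => sq_nonneg _) hlX
        have h3 : a E ≤ ∑ E ∈ T with S.mid ∈ nodesOn T E, a E :=
          Finset.single_le_sum (f := a) (fun E _ => ha E) (Finset.mem_filter.2 ⟨hE, hxE⟩)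
        refine le_trans ?_ h3
        simp only [hadef]
        have h4 : v S.mid ^ 2 ≤ 2 * (v S.mid - v S.left) ^ 2 + 2 * v S.left ^ 2 := by
          nlinarith [sq_nonneg (v S.mid - 2 * v S.left)]
        change (v S.mid - v S.left) ^ 2 ≤ 4 * elementConstant Λ σ * I E at h1
        linarith
    calc _ ≤ ∑ x ∈ lowNodes T₀ T (n + 1), ∑ E ∈ T with x ∈ nodesOn T E, a E :=
          Finset.sum_le_sum hpt
      _ ≤ 3 * (2 ^ Λ + 1) * ∑ E ∈ T, a E := hΛ.sum_node_element_le hT₀ h _ ha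
      _ = 3 * (2 ^ Λ + 1) * (8 * elementConstant Λ σ * ∑ E ∈ T, I E +
          2 * ∑ E ∈ T, ∑ y ∈ X with y ∈ nodesOn T E, v y ^ 2) := by
          simp only [hadef, Finset.sum_add_distrib, Finset.mul_sum]
      _ ≤ 3 * (2 ^ Λ + 1) * (8 * elementConstant Λ σ * ∑ E ∈ T, I E +
          2 * (4 * σ * volume.real (Metric.closedBall (0 : Plane) 1) *
            ∑ y ∈ X, v y ^ 2)) := by
          gcongr
          exact h.sum_element_node_le hT₀ hσ hσ0 X fun y => sq_nonneg (v y)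
      _ ≤ 3 * (2 ^ Λ + 1) * (8 * elementConstant Λ σ * ∑ E ∈ T, I E +
          2 * (4 * σ * volume.real (Metric.closedBall (0 : Plane) 1) *
            (nodalConstant (3 * (2 ^ Λ + 1) * (8 * elementConstant Λ σ))
              (3 * (2 ^ Λ + 1) * (2 * (4 * σ * volume.real (Metric.closedBall (0 : Plane) 1)))) n *
              ∑ E ∈ T, I E))) := by
          gcongr
      _ = _ := by
          rw [nodalConstant]
          ring

end NodalSums

/-- Scaled Poincaré inequality for virtual element functions that vanish at all proper nodes of a
`Λ`-admissible mesh. The constant depends only on `Λ` and on the shape of the initial triangles. -/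
theorem proposition3p1 (Λ : ℕ) (hΛ : 1 ≤ Λ) (σ : ℝ) :
    ∃ C : ℝ, 0 < C ∧
      ∀ (Ω : Set Plane) (T₀ : Finset MarkedTriangle),
        IsPolygonalDomain Ω → IsConformingPartition Ω T₀ → IsShapeRegular σ T₀ →
      ∀ T : Finset MarkedTriangle, IsRefinement T₀ T → IsAdmissible T₀ Λ T →
      ∀ V : (E : MarkedTriangle) → Submodule ℝ C(E.carrier, ℝ),
        (∀ E ∈ T, IsLocalVEMSpace T E (V E)) →
      ∀ (v : Plane → ℝ) (G : Plane → Plane), MemVEMSpace Ω T V v G →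
        (∀ x ∈ properNodes T, v x = 0) →
        ∑ E ∈ T, (E.size ^ 2)⁻¹ * ∫ x in E.carrier, v x ^ 2 ≤ C * ∫ x in Ω, ‖G x‖ ^ 2 := by
  classical
  -- A positive shape parameter is needed; enlarging `σ` keeps the shape bound because areas are
  -- nonnegative.
  set τ := max σ 1
  have hτ0 : 0 < τ := zero_lt_one.trans_le (le_max_right σ 1)
  set M := 4 * τ * volume.real (Metric.closedBall (0 : Plane) 1)
  set N := nodalConstant (3 * (2 ^ Λ + 1) * (8 * elementConstant Λ τ)) (3 * (2 ^ Λ + 1) * (2 * M)) Λ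
  have hC := elementConstant_nonneg Λ τ
  have hM : 0 ≤ M := by positivity
  have hN : 0 ≤ N := nodalConstant_nonneg (by positivity) (by positivity) Λ
  -- The summand 1 makes the constant strictly positive without further argument.
  refine ⟨2 * elementConstant Λ τ + 2 * (M * N) + 1, by positivity, ?_⟩
  intro Ω T₀ hΩ hT₀ hσ T h hadm V hV v G hv hv0
  have hτ : IsShapeRegular τ T₀ := fun R hR => (hσ R hR).trans
    (mul_le_mul_of_nonneg_right (le_max_left σ 1) (hT₀.nondegenerate R hR).area_pos.le)
  have hnodes := sum_sq_lowNodes_le hτ0 hΩ hT₀ hτ h hadm hV hv hv0 Λ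
  set I := ∑ E ∈ T, ∫ x in E.carrier, ‖G x‖ ^ 2
  have hI0 : 0 ≤ I := Finset.sum_nonneg fun E _ => integral_nonneg fun x => by positivity
  have hI : I ≤ ∫ x in Ω, ‖G x‖ ^ 2 := sum_integral_grad_le hΩ hT₀ h hv.memH10
  -- Any node of each element would serve as reference point. By admissibility the apex has index at
  -- most `Λ`, so its value is among those already bounded.
  have hapex : ∑ E ∈ T, v E.apex ^ 2 ≤ M * (N * I) := by
    calc ∑ E ∈ T, v E.apex ^ 2
        ≤ ∑ E ∈ T, ∑ x ∈ lowNodes T₀ T Λ with x ∈ nodesOn T E, v x ^ 2 := by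
          refine Finset.sum_le_sum fun E hE => ?_
          have hmem : E.apex ∈ nodesOn T E := h.vert_mem_nodesOn hT₀ hE 0
          obtain ⟨j, hj, hjΛ⟩ := hadm _ hmem.1
          exact Finset.single_le_sum (f := fun y => v y ^ 2) (fun y _ => sq_nonneg _)
            (Finset.mem_filter.2 ⟨mem_lowNodes.2 ⟨j, hjΛ, hj⟩, hmem⟩)
      _ ≤ M * ∑ x ∈ lowNodes T₀ T Λ, v x ^ 2 :=
          h.sum_element_node_le hT₀ hτ hτ0 _ fun y => sq_nonneg (v y)
      _ ≤ _ := mul_le_mul_of_nonneg_left hnodes hM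
  calc ∑ E ∈ T, (E.size ^ 2)⁻¹ * ∫ x in E.carrier, v x ^ 2
      ≤ ∑ E ∈ T, (2 * elementConstant Λ τ * (∫ x in E.carrier, ‖G x‖ ^ 2) + 2 * v E.apex ^ 2) :=
        Finset.sum_le_sum fun E hE => integral_sq_le hΩ hT₀ hτ h hadm hv hE (hV E hE)
          (h.vert_mem_nodesOn hT₀ hE 0)
    _ = 2 * elementConstant Λ τ * I + 2 * ∑ E ∈ T, v E.apex ^ 2 := by
        rw [Finset.sum_add_distrib, ← Finset.mul_sum, ← Finset.mul_sum]
    _ ≤ (2 * elementConstant Λ τ + 2 * (M * N) + 1) * I := by linarith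
    _ ≤ _ := mul_le_mul_of_nonneg_left hI (by positivity)
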